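/- **Quillen–Suslin theorem.** In this statement a *Dedekind domain* is an integral domain $K$ such that, for every maximal ideal $\mathfrak m$ of $K$, the localization $K_{\mathfrak m}$ is a principal ideal domain ($K$ is not assumed to be noetherian; fields are allowed). Let $n \in \{0,1,2,\dots\}$, let $K$ be a Dedekind domain, let $R = K[x_1,\dots,x_n]$, and let $P$ be a finitely generated projective $R$-module. Then there exists a finitely generated projective $K$-module $P_0$ such that $P \cong R \otimes_K P_0$ as $R$-modules. If $K$ is a principal ideal domain, then every finitely generated projective $K$-module $P_0$ with $P \cong R \otimes_K P_0$ is $K$-free, and $P$ is $R$-free. In particular, if $K$ is a field, then $P$ is $R$-free. -/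

import Mathlib

open scoped TensorProduct

universe u v

/-- A Dedekind domain in the local sense: a domain whose localization at each
maximal ideal is a PID. No noetherian hypothesis is made, so this includes the fields, the
noetherian Dedekind domains (`IsDedekindDomain`), and the non-noetherian domains that are often
called almost Dedekind. The localizations are subrings of the fraction field, hence automatically
domains, so that `IsPrincipalIdealRing` does say that they are PIDs. -/
structure IsLocallyPIDDomain (K : Type*) [CommRing K] : Prop where
  isDomain : IsDomain K
  isPrincipalIdealRing_localization :
    ∀ (m : Ideal K) [m.IsMaximal], IsPrincipalIdealRing (Localization.AtPrime m)

/-! Present P by an idempotent matrix E over K[x₁,…,xₙ]. Then P is extended from K as soon as E is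
conjugate to its constant term. This is proved by induction on n for all locally PID domains at once
(`isConj_constant_of_isLocallyPIDDomain`), because the inductive step changes the base ring.

Put B = K[x₁,…,xₙ] and let X be one more variable. Quillen patching
(`isConj_constant_of_forall_isMaximal`) reduces B[X] to the rings B_M[X], M maximal in B. Over
these, Horrocks' theorem (`isConj_stdIdempotent_of_localization_monic`) allows all monic polynomials
in X to be inverted. For a maximal m ⊇ M ∩ K, the monic localization D of K_m[X] is a PID
(`isPrincipalIdealRing_localization_monic`). Over D[x₁,…,xₙ] the induction hypothesis makes E
conjugate to a matrix over D, hence to a diagonal idempotent of ones and zeros, and this ring maps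
to the monic localization of B_M[X].

For Horrocks, let (A, 𝔪) be local and Λ the monic localization of A[X]. A conjugating matrix over
k[X], k = A/𝔪, lifts to an intertwiner V over A[X]; a given conjugating matrix U over Λ can be
adjusted so that U ≡ V mod 𝔪Λ. Nakayama gives 𝔪Λᴺ = 𝔪A[X]ᴺ + U𝔪Sᴺ, where S consists of the fractions
regular at infinity (`exists_vec_decomposition`). So V can be changed modulo 𝔪 to have the form U(1
+ Y) with Y over 𝔪S. It is then invertible over Λ and modulo 𝔪, which forces invertibility over
A[X]. -/

open Polynomial in
/-- The substitution `X ↦ c * X`. -/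
noncomputable def scaleVar {B : Type*} [CommRing B] (c : B) : B[X] →+* B[X] :=
  Polynomial.compRingHom (C c * X)

/-! ### Quillen patching -/

section Patching

open Polynomial

section Scale

variable {B B' : Type*} [CommRing B] [CommRing B'] [Algebra B B']

lemma coeff_scaleVar (c : B) (p : B[X]) (k : ℕ) :
    (scaleVar c p).coeff k = p.coeff k * c ^ k := by
  simp [scaleVar, Polynomial.comp_C_mul_X_coeff]

omit [Algebra B B'] in
lemma map_scaleVar {f : B →+* B'} (c : B) (p : B[X]) :
    mapRingHom f (scaleVar c p) = scaleVar (f c) (mapRingHom f p) := by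
  ext k
  simp [coeff_scaleVar]

lemma scaleVar_mul (c d : B) (p : B[X]) :
    scaleVar (c * d) p = scaleVar d (scaleVar c p) := by
  ext k
  simp [coeff_scaleVar, mul_pow, mul_assoc]

/-- Properties that are stable under multiples hold simultaneously for a finite family. -/
lemma exists_mem_forall_of_stable {ι : Type*} [Finite ι] (M : Submonoid B) (Q : ι → B → Prop)
    (hQ : ∀ i s t, Q i s → Q i (s * t)) (h : ∀ i, ∃ s ∈ M, Q i s) :
    ∃ s ∈ M, ∀ i, Q i s := by
  classical
  cases nonempty_fintype ι
  choose s hs hs' using h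
  refine ⟨∏ i, s i, prod_mem fun i _ => hs i, fun i => ?_⟩
  rw [← Finset.mul_prod_erase _ _ (Finset.mem_univ i)]
  exact hQ _ _ _ (hs' i)

/-- Scaling multiplies the coefficient of degree k by sᵏ, which clears a denominator s whenever k ≥
1. Only the constant term must be integral beforehand. -/
lemma exists_scaleVar_mem_range (M : Submonoid B) [IsLocalization M B'] {ι : Type*} [Finite ι]
    (f : ι → B'[X]) (b : ι → B) (hf : ∀ i, (f i).coeff 0 = algebraMap B B' (b i)) :
    ∃ s ∈ M, ∀ i, ∃ g : B[X],
      mapRingHom (algebraMap B B') g = scaleVar (algebraMap B B' s) (f i) ∧ g.coeff 0 = b i := by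
  refine exists_mem_forall_of_stable M _ ?_ ?_
  · rintro i s t ⟨g, hg, hg0⟩
    refine ⟨scaleVar t g, ?_, by simp [coeff_scaleVar, hg0]⟩
    rw [map_scaleVar, hg, map_mul, scaleVar_mul]
  · intro i
    obtain ⟨s, hs, hs'⟩ := IsLocalization.integerNormalization_spec M (f i).divX
    set q := IsLocalization.integerNormalization M (f i).divX
    -- Write f = X f₁ + b and q = s f₁. Then f(sX) = s X f₁(sX) + b = X q(sX) + b.
    refine ⟨s, hs, scaleVar s q * X + C (b i), ?_, by simp⟩
    have h1 := divX_mul_X_add (f i)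
    conv_rhs => rw [← h1, map_add, map_mul, hf]
    rw [map_add, map_mul, map_scaleVar, coe_mapRingHom, hs', Algebra.smul_def,
      IsScalarTower.algebraMap_apply B B' B'[X], Polynomial.algebraMap_eq, map_mul]
    simp [scaleVar]
    ring

/-- Each coefficient is killed by an element of M, and scaling supplies that factor in every
positive degree. This replaces injectivity of the localization map. -/
lemma exists_scaleVar_eq_zero (M : Submonoid B) [IsLocalization M B'] {ι : Type*} [Finite ι]
    (f : ι → B[X]) (h0 : ∀ i, (f i).coeff 0 = 0)
    (hf : ∀ i, mapRingHom (algebraMap B B') (f i) = 0) :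
    ∃ s ∈ M, ∀ i, scaleVar s (f i) = 0 := by
  refine exists_mem_forall_of_stable M _ ?_ ?_
  · rintro i s t h
    rw [scaleVar_mul, h, map_zero]
  · intro i
    obtain ⟨s, hs, hs'⟩ : ∃ s ∈ M, ∀ k : (f i).support, (f i).coeff k * s = 0 := by
      refine exists_mem_forall_of_stable M _ ?_ ?_
      · rintro k s t h
        rw [← mul_assoc, h, zero_mul]
      · intro k
        have h1 : algebraMap B B' ((f i).coeff k) = 0 := by
          have := congrArg (fun p => coeff p k) (hf i)
          simpa using this
        obtain ⟨s, hs⟩ := (IsLocalization.map_eq_zero_iff M B' _).1 h1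
        exact ⟨s, s.2, by rw [mul_comm, hs]⟩
    refine ⟨s, hs, ?_⟩
    ext k
    rw [coeff_scaleVar, coeff_zero]
    by_cases hk : k ∈ (f i).support
    · rcases k with _ | k
      · simp [h0 i]
      · rw [pow_succ', ← mul_assoc, hs' ⟨_, hk⟩, zero_mul]
    · rw [notMem_support_iff.1 hk, zero_mul]

end Scale

variable {n : Type*} [Fintype n] [DecidableEq n] {A : Type*} [CommRing A]

/-- `p(X) ↦ p(X + c Y)`, where `Y` is the outer variable. -/
noncomputable def shiftVar (c : A) : A[X] →+* A[X][X] :=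
  eval₂RingHom (C.comp C) (C X + C (C c) * X)

lemma constantCoeff_comp_shiftVar (c : A) :
    (constantCoeff : A[X][X] →+* A[X]).comp (shiftVar c) = RingHom.id _ := by
  apply Polynomial.ringHom_ext <;> simp [shiftVar]

lemma scaleVar_comp_shiftVar (c d : A) :
    (scaleVar (C d)).comp (shiftVar c) = shiftVar (c * d) := by
  apply Polynomial.ringHom_ext
  · intro a
    simp [shiftVar, scaleVar]
  · simp [shiftVar, scaleVar, mul_assoc]

lemma mapRingHom_comp_shiftVar {L : Type*} [CommRing L] (f : A →+* L) (c : A) :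
    (mapRingHom (mapRingHom f)).comp (shiftVar c) = (shiftVar (f c)).comp (mapRingHom f) := by
  apply Polynomial.ringHom_ext <;> simp [shiftVar]

/-- The ideal of those `c` for which `E(X + c Y)` and `E(X)` are conjugate. -/
noncomputable def shiftIdeal (E : Matrix n n A[X]) : Ideal A where
  carrier := {c | IsConj ((shiftVar c).mapMatrix E) ((C : A[X] →+* A[X][X]).mapMatrix E)}
  zero_mem' := by
    have : (shiftVar (0 : A)) = C := by
      apply Polynomial.ringHom_ext <;> simp [shiftVar]
    rw [Set.mem_ofPred, this]
  add_mem' := by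
    intro c d hc hd
    -- The substitution X ↦ X + cY, Y ↦ Y turns E(X + dY) ~ E(X) into E(X + (c+d)Y) ~ E(X + cY).
    let φ : A[X][X] →+* A[X][X] := eval₂RingHom (shiftVar c) X
    have h1 : φ.comp (shiftVar d) = shiftVar (c + d) := by
      apply Polynomial.ringHom_ext
      · intro a
        simp [shiftVar, φ]
      · simp [shiftVar, φ]
        ring
    have h2 : φ.comp C = shiftVar c := by
      refine RingHom.ext fun x => ?_
      simp [φ]
    have h3 := φ.mapMatrix.toMonoidHom.map_isConj (Set.mem_ofPred.1 hd)
    have h4 : IsConj ((φ.comp (shiftVar d)).mapMatrix E) ((φ.comp C).mapMatrix E) := h3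
    rw [h1, h2] at h4
    exact h4.trans hc
  smul_mem' := by
    intro d c hc
    have h3 := (scaleVar (C d)).mapMatrix.toMonoidHom.map_isConj (Set.mem_ofPred.1 hc)
    have h4 : IsConj (((scaleVar (C d)).comp (shiftVar c)).mapMatrix E)
      (((scaleVar (C d)).comp C).mapMatrix E) := h3
    have h2 : (scaleVar (C d : A[X])).comp C = C := by
      refine RingHom.ext fun x => ?_
      simp [scaleVar]
    rw [h2, scaleVar_comp_shiftVar, mul_comm] at h4
    exact h4

lemma isConj_of_shiftIdeal_eq_top {E : Matrix n n A[X]} (h : shiftIdeal E = ⊤) :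
    IsConj E ((C.comp constantCoeff).mapMatrix E) := by
  have h1 : (1 : A) ∈ shiftIdeal E := h ▸ Submodule.mem_top
  -- Set X = 0 and then rename Y to X: E(X + Y) ~ E(X) becomes E(X) ~ E(0).
  let φ : A[X][X] →+* A[X] := eval₂RingHom (C.comp constantCoeff) X
  have h3 := φ.mapMatrix.toMonoidHom.map_isConj (Set.mem_ofPred.1 h1)
  have h4 : IsConj ((φ.comp (shiftVar 1)).mapMatrix E) ((φ.comp C).mapMatrix E) := h3
  have h5 : φ.comp (shiftVar 1) = RingHom.id _ := by
    apply Polynomial.ringHom_ext <;> simp [shiftVar, φ]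
  have h6 : φ.comp C = C.comp constantCoeff := by
    refine RingHom.ext fun x => ?_
    simp [φ]
  rw [h5, h6] at h4
  simpa using h4

/-- If U(X) conjugates E(0) to E(X) over L, then W = U(X + Y)U(X)⁻¹ conjugates E(X) to E(X + Y) and
equals 1 at Y = 0. Replacing Y by a multiple therefore makes W descend to A. -/
lemma exists_mem_shiftIdeal (M : Submonoid A) {L : Type*} [CommRing L] [Algebra A L]
    [IsLocalization M L] {E : Matrix n n A[X]}
    (h : IsConj ((mapRingHom (algebraMap A L)).mapMatrix E)
      ((C.comp constantCoeff).mapMatrix ((mapRingHom (algebraMap A L)).mapMatrix E))) :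
    ∃ s ∈ M, s ∈ shiftIdeal E := by
  let : Algebra A[X] L[X] := Polynomial.algebra A L
  have : IsLocalization (M.map (C : A →+* A[X])) L[X] := Polynomial.isLocalization M L
  obtain ⟨U, hU⟩ := h.symm
  set EL := (mapRingHom (algebraMap A L)).mapMatrix E
  let cm : L[X][X] →+* L[X] := constantCoeff
  let W : (Matrix n n L[X][X])ˣ :=
    Units.map ((shiftVar (1 : L)).mapMatrix (m := n)).toMonoidHom U *
      (Units.map ((C : L[X] →+* L[X][X]).mapMatrix (m := n)).toMonoidHom U)⁻¹
  have hW : SemiconjBy (W : Matrix n n L[X][X]) ((C : L[X] →+* L[X][X]).mapMatrix EL)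
      ((shiftVar (1 : L)).mapMatrix EL) := by
    have h1 := hU.map ((shiftVar (1 : L)).mapMatrix (m := n))
    have h2 : SemiconjBy
      (Units.map ((C : L[X] →+* L[X][X]).mapMatrix (m := n)).toMonoidHom U : Matrix n n L[X][X])
      ((C : L[X] →+* L[X][X]).mapMatrix ((C.comp constantCoeff).mapMatrix EL))
      ((C : L[X] →+* L[X][X]).mapMatrix EL) := hU.map ((C : L[X] →+* L[X][X]).mapMatrix (m := n))
    have h3 : (shiftVar (1 : L)).mapMatrix ((C.comp constantCoeff).mapMatrix EL) =
        (C : L[X] →+* L[X][X]).mapMatrix ((C.comp constantCoeff).mapMatrix EL) := by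
      ext1 i j
      simp [shiftVar]
    rw [h3] at h1
    exact SemiconjBy.mul_left h1 h2.units_inv_symm_left
  have hW0 : Units.map (cm.mapMatrix (m := n)).toMonoidHom W = 1 := by
    have h1 : Units.map (cm.mapMatrix (m := n)).toMonoidHom
        (Units.map ((shiftVar (1 : L)).mapMatrix (m := n)).toMonoidHom U) = U := by
      ext1
      change (cm.comp (shiftVar 1)).mapMatrix (U : Matrix n n L[X]) = U
      rw [constantCoeff_comp_shiftVar]
      simp
    have h2 : Units.map (cm.mapMatrix (m := n)).toMonoidHom
        (Units.map ((C : L[X] →+* L[X][X]).mapMatrix (m := n)).toMonoidHom U) = U := by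
      ext i j
      simp [cm]
    simp only [W, map_mul, map_inv]
    rw [h1, h2, mul_inv_cancel]
  have hW0' : cm.mapMatrix (W : Matrix n n L[X][X]) = 1 := congrArg Units.val hW0
  have hW0'' : cm.mapMatrix ((W⁻¹ : (Matrix n n L[X][X])ˣ) : Matrix n n L[X][X]) = 1 := by
    have := congrArg Inv.inv hW0
    rw [← map_inv, inv_one] at this
    exact congrArg Units.val this
  -- The Boolean index handles W and W⁻¹ together, so that one s serves both.
  obtain ⟨_, ⟨s, hs, rfl⟩, hs'⟩ := exists_scaleVar_mem_range (B' := L[X]) (M.map (C : A →+* A[X]))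
    (ι := Bool × n × n)
    (fun x => (if x.1 then (W : Matrix n n L[X][X]) else
      ((W⁻¹ : (Matrix n n L[X][X])ˣ) : Matrix n n L[X][X])) x.2.1 x.2.2)
    (fun x => (1 : Matrix n n A[X]) x.2.1 x.2.2) (by
      rintro ⟨b, i, j⟩
      have e : algebraMap A[X] L[X] ((1 : Matrix n n A[X]) i j) = (1 : Matrix n n L[X]) i j := by
        rw [Matrix.one_apply, Matrix.one_apply, apply_ite (algebraMap A[X] L[X]), map_one, map_zero]
      rw [e]
      cases b
      · exact congrFun₂ hW0'' i j
      · exact congrFun₂ hW0' i j)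
  choose g hg hg0 using hs'
  let G : Matrix n n A[X][X] := Matrix.of fun i j => g (true, i, j)
  let G' : Matrix n n A[X][X] := Matrix.of fun i j => g (false, i, j)
  let mm : A[X][X] →+* L[X][X] := mapRingHom (algebraMap A[X] L[X])
  have hmm : mm = mapRingHom (mapRingHom (algebraMap A L)) := rfl
  let c0 : A[X][X] →+* A[X] := constantCoeff
  have hG0 : c0.mapMatrix G = 1 := by
    ext1 i j
    exact hg0 (true, i, j)
  have hG0' : c0.mapMatrix G' = 1 := by
    ext1 i j
    exact hg0 (false, i, j)
  have hsm : algebraMap A[X] L[X] (C s) = C (algebraMap A L s) := by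
    change mapRingHom (algebraMap A L) (C s) = _
    simp
  let σ := scaleVar (C (algebraMap A L s))
  have hG : mm.mapMatrix G = σ.mapMatrix (W : Matrix n n L[X][X]) := by
    ext1 i j
    have := hg (true, i, j)
    rw [hsm] at this
    exact this
  have hG' : mm.mapMatrix G' =
      σ.mapMatrix ((W⁻¹ : (Matrix n n L[X][X])ˣ) : Matrix n n L[X][X]) := by
    ext1 i j
    have := hg (false, i, j)
    rw [hsm] at this
    exact this
  have hE1 : mm.mapMatrix ((shiftVar s).mapMatrix E) =
      σ.mapMatrix ((shiftVar (1 : L)).mapMatrix EL) := by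
    change (mm.comp (shiftVar s)).mapMatrix E =
      ((σ.comp (shiftVar (1 : L))).comp (mapRingHom (algebraMap A L))).mapMatrix E
    rw [hmm, mapRingHom_comp_shiftVar, scaleVar_comp_shiftVar, one_mul]
  have hE2 : mm.mapMatrix ((C : A[X] →+* A[X][X]).mapMatrix E) =
      σ.mapMatrix ((C : L[X] →+* L[X][X]).mapMatrix EL) := by
    ext1 i j
    simp [hmm, σ, scaleVar, EL]
  -- The defects of the three relations wanted over A. They vanish at Y = 0 and over L, so a second
  -- scaling by some t kills them.
  let D : Fin 3 → Matrix n n A[X][X] := ![G * G' - 1, G' * G - 1,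
    G * (C : A[X] →+* A[X][X]).mapMatrix E - (shiftVar s).mapMatrix E * G]
  have hD0 : ∀ k, c0.mapMatrix (D k) = 0 := by
    have e1 : c0.mapMatrix ((C : A[X] →+* A[X][X]).mapMatrix E) = E := by
      ext1 i j
      simp [c0]
    have e2 : c0.mapMatrix ((shiftVar s).mapMatrix E) = E := by
      change (c0.comp (shiftVar s)).mapMatrix E = _
      rw [constantCoeff_comp_shiftVar]
      simp
    intro k
    fin_cases k
    · change c0.mapMatrix (G * G' - 1) = 0
      rw [map_sub, map_mul, hG0, hG0', map_one, mul_one, sub_self]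
    · change c0.mapMatrix (G' * G - 1) = 0
      rw [map_sub, map_mul, hG0, hG0', map_one, mul_one, sub_self]
    · change c0.mapMatrix (G * (C : A[X] →+* A[X][X]).mapMatrix E -
        (shiftVar s).mapMatrix E * G) = 0
      rw [map_sub, map_mul, map_mul, hG0, e1, e2, mul_one, one_mul, sub_self]
  have hDL : ∀ k, mm.mapMatrix (D k) = 0 := by
    intro k
    fin_cases k
    · change mm.mapMatrix (G * G' - 1) = 0
      rw [map_sub, map_mul, hG, hG', ← map_mul, Units.mul_inv, map_one, map_one, sub_self]
    · change mm.mapMatrix (G' * G - 1) = 0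
      rw [map_sub, map_mul, hG, hG', ← map_mul, Units.inv_mul, map_one, map_one, sub_self]
    · change mm.mapMatrix (G * (C : A[X] →+* A[X][X]).mapMatrix E -
        (shiftVar s).mapMatrix E * G) = 0
      rw [map_sub, map_mul, map_mul, hG, hE1, hE2, ← map_mul, ← map_mul, hW.eq, sub_self]
  obtain ⟨_, ⟨t, ht, rfl⟩, ht'⟩ := exists_scaleVar_eq_zero (B' := L[X]) (M.map (C : A →+* A[X]))
    (ι := Fin 3 × n × n) (fun x => D x.1 x.2.1 x.2.2)
    (fun x => congrFun₂ (hD0 x.1) x.2.1 x.2.2) (fun x => congrFun₂ (hDL x.1) x.2.1 x.2.2)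
  let τ : A[X][X] →+* A[X][X] := scaleVar (C t)
  have hτ : ∀ k, τ.mapMatrix (D k) = 0 := fun k => by
    ext1 i j
    exact ht' (k, i, j)
  refine ⟨s * t, mul_mem hs ht, IsConj.symm ⟨⟨τ.mapMatrix G, τ.mapMatrix G', ?_, ?_⟩, ?_⟩⟩
  · have : τ.mapMatrix (G * G' - 1) = 0 := hτ 0
    rwa [map_sub, map_one, sub_eq_zero, map_mul] at this
  · have : τ.mapMatrix (G' * G - 1) = 0 := hτ 1
    rwa [map_sub, map_one, sub_eq_zero, map_mul] at this
  · have : τ.mapMatrix (G * (C : A[X] →+* A[X][X]).mapMatrix E -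
        (shiftVar s).mapMatrix E * G) = 0 := hτ 2
    rw [map_sub, sub_eq_zero, map_mul, map_mul] at this
    have e1 : τ.mapMatrix ((C : A[X] →+* A[X][X]).mapMatrix E) =
        (C : A[X] →+* A[X][X]).mapMatrix E := by
      ext1 i j
      simp [τ, scaleVar]
    have e2 : τ.mapMatrix ((shiftVar s).mapMatrix E) = (shiftVar (s * t)).mapMatrix E := by
      change (τ.comp (shiftVar s)).mapMatrix E = _
      rw [scaleVar_comp_shiftVar]
    rw [e1, e2] at this
    exact this

/-- **Quillen patching** for matrices: a matrix over `A[X]` which at every maximal ideal of `A`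
becomes conjugate to its constant term is conjugate to its constant term. -/
theorem isConj_constant_of_forall_isMaximal (E : Matrix n n A[X])
    (h : ∀ (m : Ideal A) [m.IsMaximal],
      IsConj ((mapRingHom (algebraMap A (Localization.AtPrime m))).mapMatrix E)
        ((C.comp constantCoeff).mapMatrix
          ((mapRingHom (algebraMap A (Localization.AtPrime m))).mapMatrix E))) :
    IsConj E ((C.comp constantCoeff).mapMatrix E) := by
  refine isConj_of_shiftIdeal_eq_top ?_
  by_contra hne
  obtain ⟨m, hm, hle⟩ := Ideal.exists_le_maximal _ hne
  obtain ⟨s, hs, hs'⟩ := exists_mem_shiftIdeal m.primeCompl (h m)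
  exact hs (hle hs')

end Patching

/-! ### Inverting monic polynomials over a local PID -/

section PrincipalIdeal

open Polynomial

/-- The multiplicative set of monic polynomials. -/
def monicSubmonoid (A : Type*) [CommRing A] : Submonoid A[X] where
  carrier := {p | p.Monic}
  one_mem' := monic_one
  mul_mem' := Monic.mul

lemma isPrincipalIdealRing_of_isLocalization {D : Type*} [CommRing D] [IsPrincipalIdealRing D]
    (M : Submonoid D) (D' : Type*) [CommRing D'] [Algebra D D'] [IsLocalization M D'] :
    IsPrincipalIdealRing D' := by
  refine ⟨fun I => ?_⟩
  obtain ⟨a, ha⟩ := IsPrincipalIdealRing.principal (I.under D)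
  refine ⟨algebraMap D D' a, ?_⟩
  rw [← IsLocalization.map_under M D' I, ha]
  simp [Ideal.submodule_span_eq, Ideal.map_span]

lemma isLocallyPIDDomain_of_isPrincipalIdealRing (D : Type*) [CommRing D] [IsDomain D]
    [IsPrincipalIdealRing D] : IsLocallyPIDDomain D :=
  ⟨inferInstance, fun m _ => isPrincipalIdealRing_of_isLocalization m.primeCompl _⟩

section LocalRing

variable {A : Type*} [CommRing A] [IsLocalRing A]

lemma ker_mapRingHom_residue : RingHom.ker (mapRingHom (IsLocalRing.residue A)) =
    (IsLocalRing.maximalIdeal A).map (C : A →+* A[X]) := by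
  rw [Polynomial.ker_mapRingHom, IsLocalRing.ker_residue]

/-- A polynomial over a local ring that does not vanish modulo the maximal ideal is congruent to
a unit times a monic polynomial. -/
lemma exists_monic_of_map_residue_ne_zero {h : A[X]}
    (hh : mapRingHom (IsLocalRing.residue A) h ≠ 0) :
    ∃ (c : Aˣ) (g : A[X]), g.Monic ∧
      h - C (c : A) * g ∈ (IsLocalRing.maximalIdeal A).map (C : A →+* A[X]) := by
  set f := IsLocalRing.residue A
  set k := mapRingHom f h with hk
  have hc : k.leadingCoeff ≠ 0 := leadingCoeff_ne_zero.2 hh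
  obtain ⟨c, hc'⟩ := IsLocalRing.residue_surjective k.leadingCoeff
  have hcu : IsUnit c := by
    rw [← IsLocalRing.residue_ne_zero_iff_isUnit, hc']
    exact hc
  obtain ⟨g, hg, -, hgm⟩ := lifts_and_natDegree_eq_and_monic (f := f)
    (p := k * C k.leadingCoeff⁻¹)
    ((mem_lifts _).2 (map_surjective f IsLocalRing.residue_surjective _))
    (monic_mul_leadingCoeff_inv hh)
  refine ⟨hcu.unit, g, hgm, ?_⟩
  rw [← ker_mapRingHom_residue, RingHom.mem_ker, map_sub, map_mul, ← hk]
  simp only [IsUnit.unit_spec, coe_mapRingHom, map_C]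
  rw [hg, hc', mul_left_comm, ← C_mul, mul_inv_cancel₀ hc]
  simp

/-- If q is nonzero and meets A in 0, Gauss's lemma shows that any prime element of q generates it.
Otherwise q ∩ A = 𝔪, and a polynomial of q outside 𝔪A[X] would produce a monic one, so q = 𝔪A[X]. -/
lemma isPrincipal_of_forall_not_monic [IsDomain A] [IsPrincipalIdealRing A] (q : Ideal A[X])
    [hq : q.IsPrime] (hmonic : ∀ g ∈ q, ¬ g.Monic) : Submodule.IsPrincipal q := by
  classical
  by_cases hq0 : q = ⊥
  · exact hq0 ▸ inferInstance
  by_cases hqA : q.comap (C : A →+* A[X]) = ⊥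
  · obtain ⟨g, hgq, hg⟩ := hq.exists_mem_prime_of_ne_bot hq0
    refine ⟨g, le_antisymm (fun h hh => ?_) ((Ideal.span_singleton_le_iff_mem _).2 hgq)⟩
    rw [Ideal.submodule_span_eq, Ideal.mem_span_singleton]
    have hCq : ∀ a, C a ∈ q → a = 0 := fun a ha => by
      have : a ∈ q.comap (C : A →+* A[X]) := ha
      rwa [hqA] at this
    have hdeg : g.natDegree ≠ 0 := fun hd => by
      rw [eq_C_of_natDegree_eq_zero hd] at hgq hg
      exact hg.ne_zero (by rw [hCq _ hgq, C_0])
    have hprim := hg.irreducible.isPrimitive hdeg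
    let F := FractionRing A
    have hirr := (hprim.irreducible_iff_irreducible_map_fraction_map (K := F)).1 hg.irreducible
    apply hprim.dvd_of_fraction_map_dvd_fraction_map (K := F)
    -- Over the fraction field g and h would be coprime; clearing denominators in a Bézout relation
    -- puts a nonzero constant into q.
    by_contra hdvd
    obtain ⟨a, b, hab⟩ := (hirr.coprime_iff_not_dvd).2 hdvd
    obtain ⟨s, hs, hs'⟩ := IsLocalization.integerNormalization_spec (nonZeroDivisors A) a
    obtain ⟨t, ht, ht'⟩ := IsLocalization.integerNormalization_spec (nonZeroDivisors A) b
    set a' := IsLocalization.integerNormalization (nonZeroDivisors A) a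
    set b' := IsLocalization.integerNormalization (nonZeroDivisors A) b
    have key : C t * a' * g + C s * b' * h = C (s * t) := by
      apply map_injective (algebraMap A F) (IsFractionRing.injective A F)
      have e : ∀ (x : A) (p : F[X]), x • p = C (algebraMap A F x) * p := fun x p => by
        rw [Algebra.smul_def]; rfl
      simp only [Polynomial.map_add, Polynomial.map_mul, hs', ht', map_C, e, map_mul]
      linear_combination (C (algebraMap A F s) * C (algebraMap A F t)) * hab
    have h1 : C (s * t) ∈ q := by
      rw [← key]
      exact q.add_mem (q.mul_mem_left _ hgq) (q.mul_mem_left _ hh)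
    exact nonZeroDivisors.ne_zero (mul_mem hs ht) (hCq _ h1)
  · have hmax : q.comap (C : A →+* A[X]) = IsLocalRing.maximalIdeal A :=
      IsLocalRing.eq_maximalIdeal (IsPrime.to_maximal_ideal hqA)
    have hle : (IsLocalRing.maximalIdeal A).map (C : A →+* A[X]) ≤ q :=
      Ideal.map_le_iff_le_comap.2 hmax.ge
    have hqeq : q = (IsLocalRing.maximalIdeal A).map (C : A →+* A[X]) := by
      refine le_antisymm (fun h hh => ?_) hle
      by_contra hne
      rw [← ker_mapRingHom_residue, RingHom.mem_ker] at hne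
      obtain ⟨c, g, hg, hcg⟩ := exists_monic_of_map_residue_ne_zero hne
      refine hmonic g ?_ hg
      have h1 : C (c : A) * g ∈ q := by
        have := q.sub_mem hh (hle hcg)
        rwa [sub_sub_cancel] at this
      have h2 : C ((c⁻¹ : Aˣ) : A) * (C (c : A) * g) = g := by
        rw [← mul_assoc, ← C_mul, Units.inv_mul, C_1, one_mul]
      rw [← h2]
      exact q.mul_mem_left _ h1
    obtain ⟨p, hp⟩ := IsPrincipalIdealRing.principal (IsLocalRing.maximalIdeal A)
    refine ⟨C p, ?_⟩
    rw [hqeq, hp]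
    simp [Ideal.submodule_span_eq, Ideal.map_span]

/-- The localization of `A[X]` at the monic polynomials, for a local principal ideal domain `A`,
is a principal ideal ring. -/
lemma isPrincipalIdealRing_localization_monic [IsDomain A] [IsPrincipalIdealRing A] (D : Type*)
    [CommRing D] [Algebra A[X] D] [IsLocalization (monicSubmonoid A) D] :
    IsPrincipalIdealRing D := by
  -- Principality need only be tested on primes, and these contract to primes of `A[X]` without
  -- monic elements.
  refine IsPrincipalIdealRing.of_prime fun Q hQ => ?_
  have h1 := (IsLocalization.isPrime_iff_isPrime_disjoint (monicSubmonoid A) D Q).1 hQ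
  have := h1.1
  obtain ⟨a, ha⟩ := isPrincipal_of_forall_not_monic (Q.under A[X])
    fun g hg hg' => Set.disjoint_left.1 h1.2 hg' hg
  refine ⟨algebraMap A[X] D a, ?_⟩
  rw [← IsLocalization.map_under (monicSubmonoid A) D Q, ha]
  simp [Ideal.submodule_span_eq, Ideal.map_span]

end LocalRing

end PrincipalIdeal

/-! ### Standard idempotents and idempotents over a PID -/

section StandardIdempotent

variable {R : Type*} [CommRing R]

/-- The diagonal matrix with `r` ones followed by zeros. -/
def stdIdempotent (R : Type*) [CommRing R] (N r : ℕ) : Matrix (Fin N) (Fin N) R :=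
  Matrix.diagonal fun i => if (i : ℕ) < r then 1 else 0

lemma map_stdIdempotent {S : Type*} [CommRing S] (f : R →+* S) (N r : ℕ) :
    f.mapMatrix (stdIdempotent R N r) = stdIdempotent S N r := by
  rw [stdIdempotent, RingHom.mapMatrix_apply, Matrix.diagonal_map (map_zero f), stdIdempotent]
  congr 1
  funext i
  simp [apply_ite f]

lemma stdIdempotent_isIdempotentElem (N r : ℕ) : IsIdempotentElem (stdIdempotent R N r) := by
  rw [IsIdempotentElem, stdIdempotent, Matrix.diagonal_mul_diagonal]
  congr 1
  funext i
  split_ifs <;> simp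

lemma rank_stdIdempotent {F : Type*} [Field F] {N r : ℕ} (hr : r ≤ N) :
    (stdIdempotent F N r).rank = r := by
  classical
  rw [stdIdempotent, Matrix.rank_diagonal, Fintype.card_subtype]
  have : (Finset.univ.filter fun i : Fin N => (if (i : ℕ) < r then (1 : F) else 0) ≠ 0) =
      Finset.univ.filter fun i : Fin N => (i : ℕ) < r := by
    ext i
    simp
  rw [this, Fin.card_filter_val_lt, min_eq_right hr]

/-- Reduce modulo a maximal ideal and compare ranks. -/
lemma eq_of_isConj_stdIdempotent [Nontrivial R] {N r s : ℕ} (hr : r ≤ N) (hs : s ≤ N)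
    (h : IsConj (stdIdempotent R N r) (stdIdempotent R N s)) : r = s := by
  obtain ⟨m, hm⟩ := Ideal.exists_maximal R
  let F := R ⧸ m
  let := Ideal.Quotient.field m
  have h1 := (Ideal.Quotient.mk m).mapMatrix.toMonoidHom.map_isConj h
  change IsConj ((Ideal.Quotient.mk m).mapMatrix _) ((Ideal.Quotient.mk m).mapMatrix _) at h1
  rw [map_stdIdempotent, map_stdIdempotent] at h1
  obtain ⟨c, hc⟩ := h1
  have hu : IsUnit (c : Matrix (Fin N) (Fin N) (R ⧸ m)).det :=
    (Matrix.isUnit_iff_isUnit_det _).1 c.isUnit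
  have h2 := congrArg Matrix.rank hc.eq
  rwa [Matrix.rank_mul_eq_right_of_isUnit_det _ _ hu, Matrix.rank_mul_eq_left_of_isUnit_det _ _ hu,
    rank_stdIdempotent hr, rank_stdIdempotent hs] at h2

/-- The image and the kernel of E are complementary and free; a basis adapted to them diagonalizes
E. -/
lemma isConj_stdIdempotent_of_isPrincipalIdealRing [IsDomain R] [IsPrincipalIdealRing R] {N : ℕ}
    {E : Matrix (Fin N) (Fin N) R} (hE : IsIdempotentElem E) :
    ∃ r ≤ N, IsConj (stdIdempotent R N r) E := by
  let f := Matrix.toLin' E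
  have hf : IsIdempotentElem f := by
    rw [IsIdempotentElem, Module.End.mul_eq_comp, ← Matrix.toLin'_mul, hE.eq]
  obtain ⟨r, ⟨bP⟩⟩ : ∃ r, Nonempty (Module.Basis (Fin r) R (LinearMap.range f)) :=
    ⟨_, ⟨Module.finBasis _ _⟩⟩
  obtain ⟨s, ⟨bQ⟩⟩ : ∃ s, Nonempty (Module.Basis (Fin s) R (LinearMap.ker f)) :=
    ⟨_, ⟨Module.finBasis _ _⟩⟩
  have hc := LinearMap.IsIdempotentElem.isCompl hf
  let b := ((bP.prod bQ).map (Submodule.prodEquivOfIsCompl _ _ hc)).reindex finSumFinEquiv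
  have hN : r + s = N := by
    have := Module.finrank_eq_card_basis b
    simpa using this.symm
  subst hN
  refine ⟨r, Nat.le_add_right _ _, ?_⟩
  let B := Pi.basisFun R (Fin (r + s))
  refine ⟨⟨B.toMatrix b, b.toMatrix B, B.toMatrix_mul_toMatrix_flip b,
    b.toMatrix_mul_toMatrix_flip B⟩, ?_⟩
  rw [SemiconjBy, stdIdempotent]
  ext i j
  simp only [Matrix.mul_diagonal]
  have h1 : (E * B.toMatrix b) i j = f (b j) i := by
    simp [f, Matrix.mul_apply, Matrix.mulVec, dotProduct, B, Module.Basis.toMatrix_apply]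
  rw [h1]
  have h2 : B.toMatrix b i j = b j i := by
    simp [B, Module.Basis.toMatrix_apply]
  rw [h2]
  obtain ⟨k, rfl⟩ := finSumFinEquiv.surjective j
  rcases k with k | k
  · have h3 : b (finSumFinEquiv (Sum.inl k)) = bP k := by
      simp [b]
    have h4 : f (bP k) = bP k := (LinearMap.IsIdempotentElem.mem_range_iff hf).1 (bP k).2
    rw [h3, h4]
    simp
  · have h3 : b (finSumFinEquiv (Sum.inr k)) = bQ k := by
      simp [b]
    have h4 : f (bQ k) = 0 := (bQ k).2
    rw [h3, h4]
    simp

end StandardIdempotent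

/-! ### Lifting invertible matrices from a residue field -/

section LiftUnits

variable {R F : Type*} [CommRing R] [Field F] {n : Type*} [Fintype n] [DecidableEq n]

/-- Invertible matrices over a field lift along a surjection for which every nonzero element lifts
to a unit. -/
lemma exists_matrix_unit_lift (φ : R →+* F) (hφ : Function.Surjective φ)
    (hu : ∀ y : F, y ≠ 0 → ∃ u : Rˣ, φ u = y) (g : (Matrix n n F)ˣ) :
    ∃ G : (Matrix n n R)ˣ, φ.mapMatrix (G : Matrix n n R) = g := by
  classical
  let T : Submonoid (Matrix n n F) :=
    MonoidHom.mrange ((φ.mapMatrix (m := n)).toMonoidHom.comp (Units.coeHom (Matrix n n R)))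
  suffices h : (g : Matrix n n F) ∈ T from h
  -- Gaussian elimination: transvections lift because φ is surjective, the diagonal factor because
  -- its nonzero entries lift to units.
  obtain ⟨L, L', D, h⟩ :=
    Matrix.Pivot.exists_list_transvec_mul_diagonal_mul_list_transvec (g : Matrix n n F)
  have htr : ∀ t : Matrix.TransvectionStruct n F, t.toMatrix ∈ T := by
    intro t
    obtain ⟨c, hc⟩ := hφ t.c
    let t' : Matrix.TransvectionStruct n R := ⟨t.i, t.j, t.hij, c⟩
    refine ⟨⟨t'.toMatrix, t'.inv.toMatrix, t'.mul_inv, t'.inv_mul⟩, ?_⟩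
    change φ.mapMatrix t'.toMatrix = _
    ext i j
    simp [t', Matrix.TransvectionStruct.toMatrix, Matrix.transvection, Matrix.one_apply,
      Matrix.single_apply, apply_ite φ, hc]
  have hlist : ∀ L : List (Matrix.TransvectionStruct n F),
      (L.map Matrix.TransvectionStruct.toMatrix).prod ∈ T := by
    intro L
    refine Submonoid.list_prod_mem _ fun x hx => ?_
    obtain ⟨t, -, rfl⟩ := List.mem_map.1 hx
    exact htr t
  have hdet : IsUnit (g : Matrix n n F).det := (Matrix.isUnit_iff_isUnit_det _).1 g.isUnit
  have hD : ∀ i, D i ≠ 0 := by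
    rw [h, Matrix.det_mul, Matrix.det_mul, Matrix.det_diagonal] at hdet
    have h1 := isUnit_of_mul_isUnit_right (isUnit_of_mul_isUnit_left hdet)
    intro i
    exact Finset.prod_ne_zero_iff.1 h1.ne_zero i (Finset.mem_univ i)
  choose u hu' using fun i => hu (D i) (hD i)
  have hdiag : Matrix.diagonal D ∈ T := by
    refine ⟨⟨Matrix.diagonal fun i => (u i : R), Matrix.diagonal fun i => ((u i)⁻¹ : Rˣ), ?_, ?_⟩, ?_⟩
    · simp [Matrix.diagonal_mul_diagonal]
    · simp [Matrix.diagonal_mul_diagonal]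
    · change φ.mapMatrix (Matrix.diagonal fun i => (u i : R)) = _
      rw [RingHom.mapMatrix_apply, Matrix.diagonal_map (map_zero φ)]
      congr 1
      funext i
      exact hu' i
  rw [h]
  exact T.mul_mem (T.mul_mem (hlist L) hdiag) (hlist L')

/-- Commuting with diag(1, 0) means being block diagonal, so the two blocks lift separately. -/
lemma exists_matrix_unit_lift_fromBlocks {α β : Type*} [Fintype α] [DecidableEq α] [Fintype β]
    [DecidableEq β] (φ : R →+* F) (hφ : Function.Surjective φ)
    (hu : ∀ y : F, y ≠ 0 → ∃ u : Rˣ, φ u = y) (g : (Matrix (α ⊕ β) (α ⊕ β) F)ˣ)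
    (hg : Commute (g : Matrix (α ⊕ β) (α ⊕ β) F) (Matrix.fromBlocks 1 0 0 0)) :
    ∃ G : (Matrix (α ⊕ β) (α ⊕ β) R)ˣ, φ.mapMatrix (G : Matrix (α ⊕ β) (α ⊕ β) R) = g ∧
      Commute (G : Matrix (α ⊕ β) (α ⊕ β) R) (Matrix.fromBlocks 1 0 0 0) := by
  obtain ⟨a, b, c, d, hg'⟩ : ∃ a b c d, (g : Matrix (α ⊕ β) (α ⊕ β) F) =
      Matrix.fromBlocks a b c d := ⟨_, _, _, _, (Matrix.fromBlocks_toBlocks _).symm⟩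
  have h1 := hg.eq
  rw [hg', Matrix.fromBlocks_multiply, Matrix.fromBlocks_multiply, Matrix.fromBlocks_inj] at h1
  obtain ⟨-, hb, hc, -⟩ := h1
  have hb : b = 0 := by simpa using hb.symm
  have hc : c = 0 := by simpa using hc
  subst hb hc
  have hdet : IsUnit (g : Matrix (α ⊕ β) (α ⊕ β) F).det :=
    (Matrix.isUnit_iff_isUnit_det _).1 g.isUnit
  rw [hg', Matrix.det_fromBlocks_zero₂₁] at hdet
  obtain ⟨A, hA⟩ := exists_matrix_unit_lift φ hφ hu
    ((Matrix.isUnit_iff_isUnit_det a).2 (isUnit_of_mul_isUnit_left hdet)).unit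
  obtain ⟨D, hD⟩ := exists_matrix_unit_lift φ hφ hu
    ((Matrix.isUnit_iff_isUnit_det d).2 (isUnit_of_mul_isUnit_right hdet)).unit
  refine ⟨⟨Matrix.fromBlocks A 0 0 D, Matrix.fromBlocks (A⁻¹ : (Matrix α α R)ˣ) 0 0
    (D⁻¹ : (Matrix β β R)ˣ), ?_, ?_⟩, ?_, ?_⟩
  · simp [Matrix.fromBlocks_multiply]
  · simp [Matrix.fromBlocks_multiply]
  · rw [hg', RingHom.mapMatrix_apply, Matrix.fromBlocks_map]
    simp only [RingHom.mapMatrix_apply, IsUnit.unit_spec] at hA hD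
    rw [hA, hD, Matrix.map_zero _ (map_zero φ), Matrix.map_zero _ (map_zero φ)]
  · rw [commute_iff_eq]
    simp [Matrix.fromBlocks_multiply]

omit [Fintype n] [DecidableEq n] in
lemma reindex_stdIdempotent (S : Type*) [CommRing S] (N r : ℕ) :
    Matrix.reindexAlgEquiv S S (Equiv.sumCompl fun i : Fin N => (i : ℕ) < r).symm
      (stdIdempotent S N r) = Matrix.fromBlocks 1 0 0 0 := by
  ext i j
  rcases i with i | i <;> rcases j with j | j
  · have := i.2
    simp [stdIdempotent, Matrix.diagonal_apply, Matrix.one_apply, Subtype.ext_iff, this]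
  · have : (i : Fin N) ≠ j := fun h => j.2 (h ▸ i.2)
    simp [stdIdempotent, this]
  · have : (i : Fin N) ≠ j := fun h => i.2 (h ▸ j.2)
    simp [stdIdempotent, this]
  · have := i.2
    simp [stdIdempotent, Matrix.diagonal_apply, this]

lemma exists_matrix_unit_lift_commute (φ : R →+* F) (hφ : Function.Surjective φ)
    (hu : ∀ y : F, y ≠ 0 → ∃ u : Rˣ, φ u = y) {N r : ℕ} (g : (Matrix (Fin N) (Fin N) F)ˣ)
    (hg : Commute (g : Matrix (Fin N) (Fin N) F) (stdIdempotent F N r)) :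
    ∃ G : (Matrix (Fin N) (Fin N) R)ˣ, φ.mapMatrix (G : Matrix (Fin N) (Fin N) R) = g ∧
      Commute (G : Matrix (Fin N) (Fin N) R) (stdIdempotent R N r) := by
  classical
  let e := (Equiv.sumCompl fun i : Fin N => (i : ℕ) < r).symm
  let ρF := Matrix.reindexAlgEquiv F F e
  let ρR := Matrix.reindexAlgEquiv R R e
  have hg' := hg.map ρF
  rw [reindex_stdIdempotent F N r] at hg'
  obtain ⟨G, hG, hGJ⟩ := exists_matrix_unit_lift_fromBlocks φ hφ hu
    (Units.map ρF.toMulEquiv.toMonoidHom g) hg'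
  refine ⟨Units.map ρR.symm.toMulEquiv.toMonoidHom G, ?_, ?_⟩
  · apply ρF.injective
    refine Eq.trans ?_ hG
    ext i j
    change φ ((ρR (ρR.symm (G : Matrix _ _ R))) i j) = _
    rw [AlgEquiv.apply_symm_apply]
    rfl
  · have h1 := hGJ.map ρR.symm
    rw [← reindex_stdIdempotent R N r, AlgEquiv.symm_apply_apply] at h1
    exact h1

end LiftUnits

/-! ### The monic localization: residue field and fractions regular at infinity -/

section Horrocks

open Polynomial IsLocalRing

variable {A : Type*} [CommRing A] [IsLocalRing A] {Λ : Type*} [CommRing Λ] [Algebra A[X] Λ]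

omit [IsLocalRing A] in
lemma Polynomial.Monic.notMem_map_C {I : Ideal A} (hI : I ≠ ⊤) {g : A[X]} (hg : g.Monic) :
    g ∉ I.map (C : A →+* A[X]) := by
  intro h
  have h1 := Ideal.mem_map_C_iff.1 h g.natDegree
  rw [hg.coeff_natDegree] at h1
  exact hI ((Ideal.eq_top_iff_one I).2 h1)

section Residue

variable [IsLocalization (monicSubmonoid A) Λ]

lemma map_map_maximalIdeal_ne_top :
    ((maximalIdeal A).map (C : A →+* A[X])).map (algebraMap A[X] Λ) ≠ ⊤ := by
  rw [Ne, Ideal.eq_top_iff_one, IsLocalization.mem_map_algebraMap_iff (monicSubmonoid A)]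
  rintro ⟨⟨a, s⟩, h⟩
  rw [one_mul] at h
  obtain ⟨t, ht⟩ := (IsLocalization.eq_iff_exists (monicSubmonoid A) Λ).1 h
  refine Polynomial.Monic.notMem_map_C (maximalIdeal.isMaximal A).ne_top (t.2.mul s.2) ?_
  rw [ht]
  exact Ideal.mul_mem_left _ _ a.2

/-- The numerator of x is nonzero modulo 𝔪, hence congruent to a unit times a monic polynomial, and
the latter is invertible in Λ. -/
lemma exists_unit_sub_mem {x : Λ}
    (hx : x ∉ ((maximalIdeal A).map (C : A →+* A[X])).map (algebraMap A[X] Λ)) :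
    ∃ u : Λˣ, (u : Λ) - x ∈ ((maximalIdeal A).map (C : A →+* A[X])).map (algebraMap A[X] Λ) := by
  obtain ⟨⟨h, s⟩, hs⟩ := IsLocalization.surj (monicSubmonoid A) x
  obtain ⟨t, ht⟩ := IsLocalization.map_units Λ s
  change x * algebraMap A[X] Λ s = algebraMap A[X] Λ h at hs
  rw [← ht] at hs
  have hx' : x = algebraMap A[X] Λ h * (t⁻¹ : Λˣ) := by rw [← hs, Units.mul_inv_cancel_right]
  have hh : mapRingHom (residue A) h ≠ 0 := by
    intro h0
    rw [← RingHom.mem_ker, ker_mapRingHom_residue] at h0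
    exact hx (hx' ▸ Ideal.mul_mem_right _ _ (Ideal.mem_map_of_mem _ h0))
  obtain ⟨c, g, hg, hcg⟩ := exists_monic_of_map_residue_ne_zero hh
  obtain ⟨v, hv⟩ := IsLocalization.map_units Λ (⟨g, hg⟩ : monicSubmonoid A)
  refine ⟨Units.map (((algebraMap A[X] Λ).comp C : A →+* Λ) : A →* Λ) c * v * t⁻¹, ?_⟩
  have h2 := Ideal.mul_mem_right ((t⁻¹ : Λˣ) : Λ) _
    (Ideal.mem_map_of_mem (algebraMap A[X] Λ) hcg)
  rw [← neg_mem_iff]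
  convert h2 using 1
  rw [map_sub, map_mul, hx']
  simp [hv]
  ring

lemma isMaximal_map_map_maximalIdeal :
    (((maximalIdeal A).map (C : A →+* A[X])).map (algebraMap A[X] Λ)).IsMaximal := by
  rw [Ideal.isMaximal_iff]
  refine ⟨(Ideal.ne_top_iff_one _).1 map_map_maximalIdeal_ne_top, fun J x hJ hx hxJ => ?_⟩
  obtain ⟨u, hu⟩ := exists_unit_sub_mem hx
  have h1 : (u : Λ) ∈ J := by
    have := J.add_mem (hJ hu) hxJ
    rwa [sub_add_cancel] at this
  rw [Ideal.eq_top_of_isUnit_mem J h1 u.isUnit]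
  trivial

end Residue

variable [Algebra A Λ] [IsScalarTower A A[X] Λ]

/-- The fractions `a / b` with `b` monic and `deg a ≤ deg b`, that is, those that are regular at
infinity. -/
def regularAtInfinity (A Λ : Type*) [CommRing A] [CommRing Λ] [Algebra A[X] Λ] [Algebra A Λ]
    [IsScalarTower A A[X] Λ] : Subalgebra A Λ where
  carrier := {x | ∃ a b : A[X], b.Monic ∧ a.natDegree ≤ b.natDegree ∧
    x * algebraMap A[X] Λ b = algebraMap A[X] Λ a}
  mul_mem' := by
    rintro x y ⟨a, b, hb, hab, hx⟩ ⟨c, d, hd, hcd, hy⟩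
    refine ⟨a * c, b * d, hb.mul hd, ?_, ?_⟩
    · rw [hb.natDegree_mul hd]
      exact natDegree_mul_le.trans (add_le_add hab hcd)
    · rw [map_mul, map_mul, ← hx, ← hy]
      ring
  add_mem' := by
    rintro x y ⟨a, b, hb, hab, hx⟩ ⟨c, d, hd, hcd, hy⟩
    refine ⟨a * d + b * c, b * d, hb.mul hd, ?_, ?_⟩
    · rw [hb.natDegree_mul hd]
      exact natDegree_add_le_of_degree_le (natDegree_mul_le.trans (by gcongr))
        (natDegree_mul_le.trans (by gcongr))
    · rw [map_add, map_mul, map_mul, map_mul, ← hx, ← hy]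
      ring
  algebraMap_mem' := by
    intro r
    refine ⟨C r, 1, monic_one, by simp, ?_⟩
    rw [map_one, mul_one, IsScalarTower.algebraMap_apply A A[X] Λ]
    rfl

omit [IsLocalRing A] in
lemma mem_regularAtInfinity {x : Λ} : x ∈ regularAtInfinity A Λ ↔
    ∃ a b : A[X], b.Monic ∧ a.natDegree ≤ b.natDegree ∧
      x * algebraMap A[X] Λ b = algebraMap A[X] Λ a := Iff.rfl

omit [IsLocalRing A] in
lemma exists_fraction_of_mem_map {I : Ideal A} {x : regularAtInfinity A Λ}
    (hx : x ∈ I.map (algebraMap A (regularAtInfinity A Λ))) :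
    ∃ a b : A[X], b.Monic ∧ a.natDegree ≤ b.natDegree ∧ a ∈ I.map (C : A →+* A[X]) ∧
      (x : Λ) * algebraMap A[X] Λ b = algebraMap A[X] Λ a := by
  refine Submodule.span_induction ?_ ?_ ?_ ?_ hx
  · rintro _ ⟨r, hr, rfl⟩
    refine ⟨C r, 1, monic_one, by simp, Ideal.mem_map_of_mem _ hr, ?_⟩
    rw [map_one, mul_one]
    exact IsScalarTower.algebraMap_apply A A[X] Λ r
  · exact ⟨0, 1, monic_one, by simp, Ideal.zero_mem _, by simp⟩
  · rintro x y - - ⟨a, b, hb, hab, ha, hx⟩ ⟨c, d, hd, hcd, hc, hy⟩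
    refine ⟨a * d + b * c, b * d, hb.mul hd, ?_, ?_, ?_⟩
    · rw [hb.natDegree_mul hd]
      exact natDegree_add_le_of_degree_le (natDegree_mul_le.trans (by gcongr))
        (natDegree_mul_le.trans (by gcongr))
    · exact Ideal.add_mem _ (Ideal.mul_mem_right _ _ ha) (Ideal.mul_mem_left _ _ hc)
    · rw [map_add, map_mul, map_mul, map_mul, ← hx, ← hy, Subalgebra.coe_add]
      ring
  · rintro y x - ⟨a, b, hb, hab, ha, hx⟩
    obtain ⟨c, d, hd, hcd, hy⟩ := mem_regularAtInfinity.1 y.2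
    refine ⟨c * a, d * b, hd.mul hb, ?_, Ideal.mul_mem_left _ _ ha, ?_⟩
    · rw [hd.natDegree_mul hb]
      exact natDegree_mul_le.trans (add_le_add hcd hab)
    · rw [map_mul, map_mul, ← hx, ← hy, smul_eq_mul, Subalgebra.coe_mul]
      ring

/-- Here x = (a + b)/b with b monic, deg a ≤ deg b and a over 𝔪. The coefficient of a + b in degree
deg b lies in 1 + 𝔪, so a + b is a unit times a monic polynomial. The bound at infinity is what
makes this work. -/
lemma isUnit_of_sub_one_mem_map [IsLocalization (monicSubmonoid A) Λ]
    {x : regularAtInfinity A Λ}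
    (hx : x - 1 ∈ (maximalIdeal A).map (algebraMap A (regularAtInfinity A Λ))) :
    IsUnit (x : Λ) := by
  obtain ⟨a, b, hb, hab, ha, hxab⟩ := exists_fraction_of_mem_map hx
  have hx' : (x : Λ) * algebraMap A[X] Λ b = algebraMap A[X] Λ (a + b) := by
    rw [map_add, ← hxab, Subalgebra.coe_sub, Subalgebra.coe_one]
    ring
  have h1 : a.coeff b.natDegree ∈ maximalIdeal A := Ideal.mem_map_C_iff.1 ha _
  have h2 : IsUnit (a.coeff b.natDegree + 1) := by
    by_contra h
    have h3 : (1 : A) ∈ maximalIdeal A := by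
      have := (maximalIdeal A).sub_mem ((mem_maximalIdeal _).2 h) h1
      rwa [add_sub_cancel_left] at this
    exact (maximalIdeal.isMaximal A).ne_top ((Ideal.eq_top_iff_one _).2 h3)
  obtain ⟨c, hc⟩ := h2
  have h3 : (C ((c⁻¹ : Aˣ) : A) * (a + b)).Monic := by
    refine monic_of_natDegree_le_of_coeff_eq_one b.natDegree ?_ ?_
    · exact (natDegree_C_mul_le _ _).trans (natDegree_add_le_of_degree_le hab le_rfl)
    · rw [coeff_C_mul, coeff_add, hb.coeff_natDegree, ← hc, Units.inv_mul]
  have h4 : IsUnit (algebraMap A[X] Λ (C ((c⁻¹ : Aˣ) : A) * (a + b))) :=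
    IsLocalization.map_units Λ (⟨_, h3⟩ : monicSubmonoid A)
  rw [map_mul, ← hx'] at h4
  exact isUnit_of_mul_isUnit_left (isUnit_of_mul_isUnit_right h4)

/-- Two divisions with remainder: numerator by denominator, which leaves a fraction regular at
infinity, and then the quotient by s. -/
lemma exists_eq_add_of_monic [IsLocalization (monicSubmonoid A) Λ] {s : A[X]} (hs : s.Monic)
    (x : Λ) : ∃ (q r : A[X]) (ρ : regularAtInfinity A Λ), r.degree < s.degree ∧
      x = algebraMap A[X] Λ (s * q) + algebraMap A[X] Λ r + ρ := by
  obtain ⟨⟨a, b⟩, hab⟩ := IsLocalization.surj (monicSubmonoid A) x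
  have hb : (b : A[X]).Monic := b.2
  obtain ⟨v, hv⟩ := IsLocalization.map_units Λ b
  have hρ : algebraMap A[X] Λ (a %ₘ b) * (v⁻¹ : Λˣ) ∈ regularAtInfinity A Λ :=
    mem_regularAtInfinity.2 ⟨a %ₘ b, b, hb, natDegree_modByMonic_le a hb, by
      rw [← hv, Units.inv_mul_cancel_right]⟩
  refine ⟨(a /ₘ b) /ₘ s, (a /ₘ b) %ₘ s, ⟨_, hρ⟩, degree_modByMonic_lt _ hs, ?_⟩
  · have h1 : a = b * (s * ((a /ₘ b) /ₘ s) + (a /ₘ b) %ₘ s) + a %ₘ b := by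
      rw [add_comm (s * _), modByMonic_add_div, add_comm, modByMonic_add_div]
    have h2 : x = algebraMap A[X] Λ a * (v⁻¹ : Λˣ) := by
      rw [← hab, ← hv, Units.mul_inv_cancel_right]
    conv_lhs => rw [h2, h1]
    rw [map_add, map_mul, ← hv, map_add, add_mul, mul_comm (v : Λ), Units.mul_inv_cancel_right]

omit [IsLocalRing A] in
lemma mem_smul_top_pi_iff {ι B : Type*} [Finite ι] [CommRing B] [Algebra A B] (I : Ideal A)
    (v : ι → B) :
    v ∈ I • (⊤ : Submodule A (ι → B)) ↔ ∀ i, v i ∈ I.map (algebraMap A B) := by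
  classical
  cases nonempty_fintype ι
  constructor
  · intro h i
    have h1 : v i ∈ Submodule.map (LinearMap.proj i) (I • (⊤ : Submodule A (ι → B))) :=
      ⟨v, h, rfl⟩
    rw [Submodule.map_smul''] at h1
    have h2 : v i ∈ I • (⊤ : Submodule A B) := Submodule.smul_mono le_rfl le_top h1
    rwa [Ideal.smul_top_eq_map] at h2
  · intro h
    rw [← Finset.univ_sum_single v]
    refine Submodule.sum_mem _ fun i _ => ?_
    have h1 : v i ∈ I • (⊤ : Submodule A B) := by
      rw [Ideal.smul_top_eq_map]
      exact h i
    have h2 : Pi.single i (v i) ∈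
        Submodule.map (LinearMap.single A (fun _ : ι => B) i) (I • (⊤ : Submodule A B)) :=
      ⟨_, h1, rfl⟩
    rw [Submodule.map_smul''] at h2
    exact Submodule.smul_mono le_rfl le_top h2

end Horrocks

/-! ### Nakayama decomposition over the monic localization -/

section Horrocks

open Polynomial IsLocalRing

variable {A : Type*} [CommRing A] [IsLocalRing A] {Λ : Type*} [CommRing Λ] [Algebra A[X] Λ]
  [IsLocalization (monicSubmonoid A) Λ] [Algebra A Λ] [IsScalarTower A A[X] Λ] {N : ℕ}

lemma exists_vec_decomposition (U : (Matrix (Fin N) (Fin N) Λ)ˣ) (V : Matrix (Fin N) (Fin N) A[X])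
    (hUV : ∀ i j, (U : Matrix (Fin N) (Fin N) Λ) i j - algebraMap A[X] Λ (V i j) ∈
      (maximalIdeal A).map (algebraMap A Λ))
    (v : Fin N → Λ) (hv : ∀ i, v i ∈ (maximalIdeal A).map (algebraMap A Λ)) :
    ∃ (w : Fin N → A[X]) (y : Fin N → regularAtInfinity A Λ),
      (∀ i, w i ∈ (maximalIdeal A).map (algebraMap A A[X])) ∧
      (∀ i, y i ∈ (maximalIdeal A).map (algebraMap A (regularAtInfinity A Λ))) ∧
      v = (fun i => algebraMap A[X] Λ (w i)) +
        (U : Matrix (Fin N) (Fin N) Λ).mulVec fun i => (y i : Λ) := by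
  let m := maximalIdeal A
  let UL : (Fin N → Λ) →ₗ[A] (Fin N → Λ) :=
    (Matrix.mulVecLin (U : Matrix (Fin N) (Fin N) Λ)).restrictScalars A
  let f₁ : (Fin N → A[X]) →ₗ[A] (Fin N → Λ) :=
    (IsScalarTower.toAlgHom A A[X] Λ).toLinearMap.compLeft (Fin N)
  let f₂ : (Fin N → regularAtInfinity A Λ) →ₗ[A] (Fin N → Λ) :=
    UL ∘ₗ (regularAtInfinity A Λ).val.toLinearMap.compLeft (Fin N)
  let N₁ := LinearMap.range f₁
  let N₂ := LinearMap.range f₂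
  -- With a common monic denominator s of U, the vectors U s q are polynomial. So N₁ + N₂ misses at
  -- most the image N₃ under U of polynomial vectors of degree < deg s, which is finite over A.
  obtain ⟨s, hs⟩ := IsLocalization.exist_integer_multiples_of_finite (monicSubmonoid A)
    (fun x : Fin N × Fin N => (U : Matrix (Fin N) (Fin N) Λ) x.1 x.2)
  choose U₀ hU₀ using hs
  let d := (s : A[X]).natDegree
  let f₃ : (Fin N → Fin d → A) →ₗ[A] (Fin N → Λ) :=
    UL ∘ₗ f₁ ∘ₗ ((degreeLT A d).subtype ∘ₗ (degreeLTEquiv A d).symm.toLinearMap).compLeft (Fin N)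
  let N₃ := LinearMap.range f₃
  have hN₃ : N₃.FG := Module.Finite.iff_fg.1 inferInstance
  have hU : ∀ x : Fin N → Λ, UL ((U⁻¹ : (Matrix (Fin N) (Fin N) Λ)ˣ).1.mulVec x) = x := by
    intro x
    change (U : Matrix (Fin N) (Fin N) Λ).mulVec _ = x
    rw [Matrix.mulVec_mulVec, Units.mul_inv, Matrix.one_mulVec]
  have h1 : (⊤ : Submodule A (Fin N → Λ)) ≤ (N₁ ⊔ N₂) ⊔ N₃ := by
    intro x _
    choose q r ρ hr hx using fun i => exists_eq_add_of_monic (A := A) (Λ := Λ) (s := s) s.2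
      ((U⁻¹ : (Matrix (Fin N) (Fin N) Λ)ˣ).1.mulVec x i)
    have e : x = UL (f₁ fun i => s * q i) + f₂ ρ + UL (f₁ r) := by
      conv_lhs => rw [← hU x]
      change _ = UL _ + UL _ + UL _
      rw [← map_add, ← map_add]
      congr 1
      funext i
      rw [hx i]
      change _ = algebraMap A[X] Λ (s * q i) + (ρ i : Λ) + algebraMap A[X] Λ (r i)
      ring
    rw [e]
    refine Submodule.add_mem_sup (Submodule.add_mem_sup ?_ ⟨ρ, rfl⟩) ?_
    · refine ⟨fun i => ∑ j, U₀ (i, j) * q j, ?_⟩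
      funext i
      change algebraMap A[X] Λ (∑ j, U₀ (i, j) * q j) =
        ∑ j, (U : Matrix (Fin N) (Fin N) Λ) i j * algebraMap A[X] Λ (s * q j)
      rw [map_sum]
      refine Finset.sum_congr rfl fun j _ => ?_
      rw [map_mul, hU₀, map_mul, Algebra.smul_def]
      ring
    · refine ⟨fun i => degreeLTEquiv A d ⟨r i, mem_degreeLT.2 ?_⟩, ?_⟩
      · rw [← degree_eq_natDegree (Monic.ne_zero s.2)]
        exact hr i
      · change UL (f₁ fun i => ((degreeLTEquiv A d).symm (degreeLTEquiv A d _) : A[X])) = _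
        simp only [LinearEquiv.symm_apply_apply]
  -- Division by s = 1 leaves no remainder: x = Uq + Uρ, and Uq ≡ Vq modulo 𝔪.
  have h2 : (⊤ : Submodule A (Fin N → Λ)) ≤ (N₁ ⊔ N₂) ⊔ m • ⊤ := by
    intro x _
    choose q r ρ hr hx using fun i => exists_eq_add_of_monic (A := A) (Λ := Λ) monic_one
      ((U⁻¹ : (Matrix (Fin N) (Fin N) Λ)ˣ).1.mulVec x i)
    have hr0 : ∀ i, r i = 0 := fun i => by
      have := hr i
      rw [degree_one] at this
      exact degree_eq_bot.1 (Nat.WithBot.lt_zero_iff.1 this)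
    have e : x = f₁ (V.mulVec q) + f₂ ρ + (UL (f₁ q) - f₁ (V.mulVec q)) := by
      have e1 : x = UL (f₁ q) + f₂ ρ := by
        conv_lhs => rw [← hU x]
        change _ = UL _ + UL _
        rw [← map_add]
        congr 1
        funext i
        rw [hx i, hr0 i, one_mul, map_zero, add_zero]
        rfl
      conv_lhs => rw [e1]
      abel
    rw [e]
    refine Submodule.add_mem_sup (Submodule.add_mem_sup ⟨_, rfl⟩ ⟨ρ, rfl⟩) ?_
    rw [mem_smul_top_pi_iff]
    intro i
    change ∑ j, (U : Matrix (Fin N) (Fin N) Λ) i j * algebraMap A[X] Λ (q j) -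
      algebraMap A[X] Λ (∑ j, V i j * q j) ∈ _
    rw [map_sum, ← Finset.sum_sub_distrib]
    refine Ideal.sum_mem _ fun j _ => ?_
    rw [map_mul, ← sub_mul]
    exact Ideal.mul_mem_right _ _ (hUV i j)
  -- Together the two bounds give N₃ ≤ N₁ + N₂ + 𝔪N₃, and Nakayama applies because N₃ is finitely
  -- generated.
  have h3 : N₃ ≤ N₁ ⊔ N₂ := by
    refine Submodule.le_of_le_smul_of_le_jacobson_bot hN₃ (maximalIdeal_le_jacobson _)
      (le_top.trans (h2.trans ?_))
    refine sup_le le_sup_left ((Submodule.smul_mono (le_refl m) h1).trans ?_)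
    rw [Submodule.smul_sup]
    exact sup_le_sup_right Submodule.smul_le_right _
  have h4 : (⊤ : Submodule A (Fin N → Λ)) ≤ N₁ ⊔ N₂ := h1.trans (sup_le le_rfl h3)
  have h5 : v ∈ m • N₁ ⊔ m • N₂ := by
    rw [← Submodule.smul_sup]
    exact Submodule.smul_mono (le_refl m) h4 ((mem_smul_top_pi_iff m v).2 hv)
  obtain ⟨w', hw', y', hy', rfl⟩ := Submodule.mem_sup.1 h5
  simp only [N₁, N₂, LinearMap.range_eq_map, ← Submodule.map_smul''] at hw' hy'
  obtain ⟨w, hw, rfl⟩ := hw'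
  obtain ⟨y, hy, rfl⟩ := hy'
  exact ⟨w, y, (mem_smul_top_pi_iff m w).1 hw, (mem_smul_top_pi_iff m y).1 hy, rfl⟩

/-- Applied column by column. Rearranged, the equation reads V - W = U(1 + Y): a polynomial matrix
differing from U by a factor near 1 at infinity. -/
lemma exists_matrix_decomposition (U : (Matrix (Fin N) (Fin N) Λ)ˣ)
    (V : Matrix (Fin N) (Fin N) A[X])
    (hUV : ∀ i j, (U : Matrix (Fin N) (Fin N) Λ) i j - algebraMap A[X] Λ (V i j) ∈
      (maximalIdeal A).map (algebraMap A Λ)) :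
    ∃ (W : Matrix (Fin N) (Fin N) A[X]) (Y : Matrix (Fin N) (Fin N) (regularAtInfinity A Λ)),
      (∀ i j, W i j ∈ (maximalIdeal A).map (algebraMap A A[X])) ∧
      (∀ i j, Y i j ∈ (maximalIdeal A).map (algebraMap A (regularAtInfinity A Λ))) ∧
      (algebraMap A[X] Λ).mapMatrix V - U = (algebraMap A[X] Λ).mapMatrix W +
        U * (regularAtInfinity A Λ).val.toRingHom.mapMatrix Y := by
  choose w y hw hy h using fun j => exists_vec_decomposition U V hUV
    (fun i => algebraMap A[X] Λ (V i j) - (U : Matrix (Fin N) (Fin N) Λ) i j)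
    (fun i => by rw [← neg_sub]; exact neg_mem (hUV i j))
  refine ⟨Matrix.of fun i j => w j i, Matrix.of fun i j => y j i, fun i j => hw j i,
    fun i j => hy j i, ?_⟩
  ext i j
  exact congrFun (h j) i

omit [IsLocalization (monicSubmonoid A) Λ] [Algebra A Λ] [IsScalarTower A A[X] Λ] in
/-- Over a local ring, a divisor of a monic polynomial which is a unit modulo the maximal ideal
is a unit. -/
lemma isUnit_of_dvd_monic {p s : A[X]} (hs : s.Monic) (hps : p ∣ s)
    (hp : IsUnit (mapRingHom (residue A) p)) : IsUnit p := by
  let I := Ideal.span {p}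
  -- A[X]/(p) is a quotient of the finite A-module A[X]/(s) and vanishes modulo 𝔪, so it is zero by
  -- Nakayama.
  have hfin : Module.Finite A (A[X] ⧸ Ideal.span {s}) := hs.finite_quotient
  have hle : Ideal.span {s} ≤ I := Ideal.span_singleton_le_span_singleton.2 hps
  have : Module.Finite A (A[X] ⧸ I) :=
    Module.Finite.of_surjective (Ideal.Quotient.factorₐ A hle).toLinearMap
      (Ideal.Quotient.factor_surjective hle)
  obtain ⟨c, hc⟩ := hp.exists_right_inv
  obtain ⟨c, rfl⟩ := map_surjective _ residue_surjective c
  have hmem : 1 - p * c ∈ (maximalIdeal A).map (C : A →+* A[X]) := by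
    rw [← ker_mapRingHom_residue, RingHom.mem_ker, map_sub, map_one, map_mul]
    exact sub_eq_zero.2 hc.symm
  have h1 : ((maximalIdeal A).map (algebraMap A (A[X] ⧸ I))) = ⊤ := by
    rw [Ideal.eq_top_iff_one, IsScalarTower.algebraMap_eq A A[X], ← Ideal.map_map]
    have h2 := Ideal.mem_map_of_mem (algebraMap A[X] (A[X] ⧸ I)) hmem
    rw [map_sub, map_mul, map_one] at h2
    have h3 : algebraMap A[X] (A[X] ⧸ I) p = 0 :=
      Ideal.Quotient.eq_zero_iff_mem.2 (Ideal.mem_span_singleton_self p)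
    rwa [h3, zero_mul, sub_zero] at h2
  have h2 : (⊤ : Submodule A (A[X] ⧸ I)) = ⊥ := by
    refine Submodule.eq_bot_of_le_smul_of_le_jacobson_bot (maximalIdeal A) _
      (Module.Finite.fg_top) ?_ (maximalIdeal_le_jacobson _)
    rw [Ideal.smul_top_eq_map, h1]
    exact le_rfl
  have h3 : (1 : A[X] ⧸ I) = 0 := by
    have : (1 : A[X] ⧸ I) ∈ (⊤ : Submodule A (A[X] ⧸ I)) := trivial
    rwa [h2, Submodule.mem_bot] at this
  have h4 : (1 : A[X]) ∈ I := Ideal.Quotient.eq_zero_iff_mem.1 h3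
  exact isUnit_iff_dvd_one.2 (Ideal.mem_span_singleton.1 h4)

end Horrocks

/-! ### Projection onto intertwiners of two idempotents -/

/-- The part of `x` that intertwines the idempotents `e` and `j`. -/
def intertwiningPart {S : Type*} [Ring S] (e j x : S) : S := e * x * j + (1 - e) * x * (1 - j)

section IntertwiningPart

variable {S T : Type*} [Ring S] [Ring T] {e j : S}

lemma intertwiningPart_sub (e j x y : S) :
    intertwiningPart e j (x - y) = intertwiningPart e j x - intertwiningPart e j y := by
  simp only [intertwiningPart]
  noncomm_ring

lemma intertwiningPart_add (e j x y : S) :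
    intertwiningPart e j (x + y) = intertwiningPart e j x + intertwiningPart e j y := by
  simp only [intertwiningPart]
  noncomm_ring

lemma map_intertwiningPart (f : S →+* T) (e j x : S) :
    f (intertwiningPart e j x) = intertwiningPart (f e) (f j) (f x) := by
  simp [intertwiningPart]

lemma semiconjBy_intertwiningPart (he : IsIdempotentElem e) (hj : IsIdempotentElem j) (x : S) :
    SemiconjBy (intertwiningPart e j x) j e := by
  have h1 : (1 - j) * j = 0 := hj.one_sub_mul_self
  have h2 : e * (1 - e) = 0 := he.mul_one_sub_self
  rw [SemiconjBy, intertwiningPart, add_mul, mul_add, mul_assoc _ j, hj.eq, mul_assoc _ (1 - j), h1,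
    mul_zero, add_zero, ← mul_assoc, ← mul_assoc, he.eq, ← mul_assoc, ← mul_assoc, h2]
  simp

/-- Projecting the decomposition V - U = W + UY onto intertwiners thus preserves its shape, with Y
replaced by its part commuting with `j`. -/
lemma intertwiningPart_mul {u : S} (hu : SemiconjBy u j e) (z : S) :
    intertwiningPart e j (u * z) = u * intertwiningPart j j z := by
  have h1 : (1 - e) * u = u * (1 - j) := by rw [sub_mul, mul_sub, hu.eq, one_mul, mul_one]
  rw [intertwiningPart, intertwiningPart, ← mul_assoc, ← mul_assoc, ← hu.eq, h1, mul_add]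
  simp only [mul_assoc]

lemma intertwiningPart_eq_self (hj : IsIdempotentElem j) {u : S} (hu : SemiconjBy u j e) :
    intertwiningPart e j u = u := by
  have := intertwiningPart_mul hu 1
  rw [mul_one] at this
  rw [this, intertwiningPart, mul_one, mul_one, hj.eq, hj.one_sub.eq, add_sub_cancel, mul_one]

end IntertwiningPart

/-! ### Horrocks' theorem -/

section Horrocks

open Polynomial IsLocalRing

variable {A : Type*} [CommRing A] [IsLocalRing A]

/-- **Horrocks' theorem**: over a local ring `A`, an idempotent matrix over `A[X]` that becomes
conjugate to a standard one after inverting the monic polynomials is so over `A[X]`. -/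
theorem isConj_stdIdempotent_of_localization_monic (Λ : Type*) [CommRing Λ] [Algebra A[X] Λ]
    [IsLocalization (monicSubmonoid A) Λ] [Algebra A Λ] [IsScalarTower A A[X] Λ] {N r : ℕ}
    {E : Matrix (Fin N) (Fin N) A[X]} (hE : IsIdempotentElem E) (hr : r ≤ N)
    (h : IsConj (stdIdempotent Λ N r) ((algebraMap A[X] Λ).mapMatrix E)) :
    IsConj (stdIdempotent A[X] N r) E := by
  classical
  let ρ : A[X] →+* (ResidueField A)[X] := mapRingHom (residue A)
  have hρ : Function.Surjective ρ := map_surjective _ residue_surjective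
  have hkerρ : ∀ a, ρ a = 0 ↔ a ∈ (maximalIdeal A).map (C : A →+* A[X]) := fun a => by
    rw [← ker_mapRingHom_residue, RingHom.mem_ker]
  let 𝔐 := ((maximalIdeal A).map (C : A →+* A[X])).map (algebraMap A[X] Λ)
  have h𝔐 : (maximalIdeal A).map (algebraMap A Λ) = 𝔐 := by
    rw [IsScalarTower.algebraMap_eq A A[X] Λ, ← Ideal.map_map]
    rfl
  have : 𝔐.IsMaximal := isMaximal_map_map_maximalIdeal
  let := Ideal.Quotient.field 𝔐
  let q := Ideal.Quotient.mk 𝔐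
  -- Through θ the conjugating matrices over k[X] and over Λ can be compared in the field Λ/𝔐.
  let θ : (ResidueField A)[X] →+* Λ ⧸ 𝔐 := RingHom.liftOfSurjective ρ hρ
    ⟨q.comp (algebraMap A[X] Λ), fun a ha => Ideal.Quotient.eq_zero_iff_mem.2
      (Ideal.mem_map_of_mem _ ((hkerρ a).1 ha))⟩
  have hθ : θ.comp ρ = q.comp (algebraMap A[X] Λ) := RingHom.liftOfRightInverse_comp _ _ _ _
  obtain ⟨U, hU⟩ := h
  obtain ⟨r', hr', Vk, hVk⟩ := isConj_stdIdempotent_of_isPrincipalIdealRing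
    (hE.map (ρ.mapMatrix (m := Fin N)))
  let vκ := Units.map (θ.mapMatrix (m := Fin N)).toMonoidHom Vk
  let uκ := Units.map (q.mapMatrix (m := Fin N)).toMonoidHom U
  have hvκ : SemiconjBy (vκ : Matrix (Fin N) (Fin N) (Λ ⧸ 𝔐)) (stdIdempotent _ N r')
      ((θ.comp ρ).mapMatrix E) := by
    have := hVk.map (θ.mapMatrix (m := Fin N))
    rwa [map_stdIdempotent] at this
  have huκ : SemiconjBy (uκ : Matrix (Fin N) (Fin N) (Λ ⧸ 𝔐)) (stdIdempotent _ N r)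
      ((θ.comp ρ).mapMatrix E) := by
    have := hU.map (q.mapMatrix (m := Fin N))
    rw [map_stdIdempotent] at this
    rwa [hθ]
  obtain rfl : r = r' := eq_of_isConj_stdIdempotent hr hr'
    (IsConj.trans ⟨uκ, huκ⟩ (IsConj.symm ⟨vκ, hvκ⟩))
  have hunit : ∀ y : Λ ⧸ 𝔐, y ≠ 0 → ∃ u : Λˣ, q u = y := by
    intro y hy
    obtain ⟨x, rfl⟩ := Ideal.Quotient.mk_surjective y
    obtain ⟨u, hu⟩ := exists_unit_sub_mem (A := A) fun hx => hy (Ideal.Quotient.eq_zero_iff_mem.2 hx)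
    exact ⟨u, Ideal.Quotient.eq.2 hu⟩
  -- The discrepancy uκ⁻¹vκ commutes with the standard idempotent. Lifting it with that property
  -- lets UG agree with Vk modulo 𝔐 and still conjugate.
  obtain ⟨G, hG, hGJ⟩ := exists_matrix_unit_lift_commute (r := r) q Ideal.Quotient.mk_surjective hunit
    (uκ⁻¹ * vκ) (SemiconjBy.mul_left huκ.units_inv_symm_left hvκ)
  have hJ : IsIdempotentElem (stdIdempotent A[X] N r) := stdIdempotent_isIdempotentElem N r
  let U₁ := U * G
  have hU₁ : SemiconjBy (U₁ : Matrix (Fin N) (Fin N) Λ) (stdIdempotent Λ N r)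
    ((algebraMap A[X] Λ).mapMatrix E) := SemiconjBy.mul_left hU hGJ
  have hqU₁ : q.mapMatrix (U₁ : Matrix (Fin N) (Fin N) Λ) = vκ := by
    have : q.mapMatrix (U₁ : Matrix (Fin N) (Fin N) Λ) = uκ * (uκ⁻¹ * vκ : (Matrix _ _ _)ˣ) := by
      rw [← hG]
      exact map_mul _ _ _
    rw [this, ← Units.val_mul, mul_inv_cancel_left]
  obtain ⟨V₁, hV₁⟩ : ∃ V₁ : Matrix (Fin N) (Fin N) A[X], ρ.mapMatrix V₁ = Vk := by
    choose V₁ h using fun i j => hρ ((Vk : Matrix (Fin N) (Fin N) _) i j)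
    exact ⟨Matrix.of V₁, by ext1 i j; exact h i j⟩
  let V₀ := intertwiningPart E (stdIdempotent A[X] N r) V₁
  have hV₀ : SemiconjBy V₀ (stdIdempotent A[X] N r) E := semiconjBy_intertwiningPart hE hJ _
  have hρV₀ : ρ.mapMatrix V₀ = Vk := by
    rw [map_intertwiningPart, map_stdIdempotent, hV₁]
    exact intertwiningPart_eq_self (stdIdempotent_isIdempotentElem N r) hVk
  have hqV₀ : q.mapMatrix ((algebraMap A[X] Λ).mapMatrix V₀) = vκ := by
    change (q.comp (algebraMap A[X] Λ)).mapMatrix V₀ = θ.mapMatrix (Vk : Matrix (Fin N) (Fin N) _)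
    rw [← hθ, ← hρV₀]
    rfl
  obtain ⟨W, Y, hW, hY, hVU⟩ := exists_matrix_decomposition U₁ V₀ fun i j => by
    rw [h𝔐, ← Ideal.Quotient.eq]
    exact congrFun₂ (hqU₁.trans hqV₀.symm) i j
  let ι := (regularAtInfinity A Λ).val.toRingHom
  let Y₂ := intertwiningPart (stdIdempotent _ N r) (stdIdempotent _ N r) Y
  let V := V₀ - intertwiningPart E (stdIdempotent A[X] N r) W
  have hV : SemiconjBy V (stdIdempotent A[X] N r) E :=
    hV₀.sub_left (semiconjBy_intertwiningPart hE hJ _)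
  have hVΛ : (algebraMap A[X] Λ).mapMatrix V = U₁ * (1 + ι.mapMatrix Y₂) := by
    have h1 := congrArg (intertwiningPart ((algebraMap A[X] Λ).mapMatrix E)
      (stdIdempotent Λ N r)) hVU
    have h2 := hV₀.map (algebraMap A[X] Λ).mapMatrix
    rw [map_stdIdempotent] at h2
    rw [intertwiningPart_sub, intertwiningPart_add,
      intertwiningPart_eq_self (stdIdempotent_isIdempotentElem N r) h2,
      intertwiningPart_eq_self (stdIdempotent_isIdempotentElem N r) hU₁,
      intertwiningPart_mul hU₁] at h1
    have hVW : (algebraMap A[X] Λ).mapMatrix V = (algebraMap A[X] Λ).mapMatrix V₀ -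
        intertwiningPart ((algebraMap A[X] Λ).mapMatrix E) (stdIdempotent Λ N r)
          ((algebraMap A[X] Λ).mapMatrix W) := by
      rw [map_sub, map_intertwiningPart _ _ _ W, map_stdIdempotent]
    have hY₂ : ι.mapMatrix Y₂ = intertwiningPart (stdIdempotent Λ N r) (stdIdempotent Λ N r)
        (ι.mapMatrix Y) := by
      rw [map_intertwiningPart, map_stdIdempotent]
    have h1 : _ = _ + _ * intertwiningPart _ _ (ι.mapMatrix Y) := h1
    rw [hVW, hY₂, mul_add, mul_one, sub_eq_iff_eq_add, add_assoc, add_comm _ (intertwiningPart _ _ _), ← h1]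
    abel
  have hdet1 : IsUnit (1 + ι.mapMatrix Y₂).det := by
    have h1 : (1 + ι.mapMatrix Y₂).det = ι (1 + Y₂).det := by
      rw [RingHom.map_det, map_add, map_one]
    rw [h1]
    refine isUnit_of_sub_one_mem_map (A := A) (Λ := Λ) (x := (1 + Y₂).det) ?_
    set I := (maximalIdeal A).map (algebraMap A (regularAtInfinity A Λ))
    rw [← Ideal.Quotient.eq_zero_iff_mem, map_sub, RingHom.map_det, map_add, map_one, map_one,
      map_intertwiningPart]
    have h2 : (Ideal.Quotient.mk I).mapMatrix Y = 0 := by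
      ext1 i j
      exact Ideal.Quotient.eq_zero_iff_mem.2 (hY i j)
    rw [h2]
    simp [intertwiningPart]
  have hdetΛ : IsUnit (algebraMap A[X] Λ V.det) := by
    rw [RingHom.map_det, hVΛ, Matrix.det_mul]
    exact ((Matrix.isUnit_iff_isUnit_det _).1 U₁.isUnit).mul hdet1
  have hdetρ : IsUnit (ρ V.det) := by
    have h1 : ρ.mapMatrix W = 0 := by
      ext1 i j
      exact (hkerρ _).2 (hW i j)
    rw [RingHom.map_det, map_sub, hρV₀, map_intertwiningPart, h1]
    simp [intertwiningPart]
  -- A unit of Λ coming from A[X] divides a monic polynomial.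
  obtain ⟨y, hy⟩ := hdetΛ.exists_right_inv
  obtain ⟨⟨a, s⟩, has⟩ := IsLocalization.surj (monicSubmonoid A) y
  obtain ⟨t, ht⟩ := (IsLocalization.eq_iff_exists (monicSubmonoid A) Λ).1
    (show algebraMap A[X] Λ (V.det * a) = algebraMap A[X] Λ s by
      rw [map_mul, ← has, ← mul_assoc, hy, one_mul])
  have hdet : IsUnit V.det := isUnit_of_dvd_monic (t.2.mul s.2 : (t * s : A[X]).Monic)
    ⟨t * a, by rw [← ht]; ring⟩ hdetρ
  exact ⟨((Matrix.isUnit_iff_isUnit_det V).2 hdet).unit, hV⟩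

end Horrocks

/-! ### Induction on the number of variables -/

section Induction

open Polynomial

lemma isUnit_algebraMap_of_monic {A Λ : Type*} [CommRing A] [CommRing Λ] [Algebra A[X] Λ]
    [IsLocalization (monicSubmonoid A) Λ] {p : A[X]} (hp : p.Monic) :
    IsUnit (algebraMap A[X] Λ p) :=
  IsLocalization.map_units Λ (⟨p, hp⟩ : monicSubmonoid A)

lemma IsConj.mapMatrix_stdIdempotent {R S : Type*} [CommRing R] [CommRing S] (f : R →+* S)
    {N r : ℕ} {E : Matrix (Fin N) (Fin N) R} (h : IsConj (stdIdempotent R N r) E) :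
    IsConj (stdIdempotent S N r) (f.mapMatrix E) := by
  have h1 : IsConj (f.mapMatrix _) (f.mapMatrix E) :=
    (f.mapMatrix (m := Fin N)).toMonoidHom.map_isConj h
  rwa [map_stdIdempotent] at h1

/-- The standard idempotent has entries 0 and 1, so passing to constant terms leaves it unchanged.
-/
lemma isConj_constant_of_isConj_stdIdempotent {A : Type*} [CommRing A] {N r : ℕ}
    {E : Matrix (Fin N) (Fin N) A[X]} (h : IsConj (stdIdempotent A[X] N r) E) :
    IsConj E ((C.comp constantCoeff).mapMatrix E) :=
  h.symm.trans (h.mapMatrix_stdIdempotent _)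

lemma exists_isConj_stdIdempotent_of_isConj_constant {D : Type*} [CommRing D] [IsDomain D]
    [IsPrincipalIdealRing D] {σ : Type*} {N : ℕ} {E : Matrix (Fin N) (Fin N) (MvPolynomial σ D)}
    (hE : IsIdempotentElem E)
    (h : IsConj E ((MvPolynomial.C.comp MvPolynomial.constantCoeff).mapMatrix E)) :
    ∃ r ≤ N, IsConj (stdIdempotent (MvPolynomial σ D) N r) E := by
  obtain ⟨r, hr, h1⟩ := isConj_stdIdempotent_of_isPrincipalIdealRing
    (hE.map ((MvPolynomial.constantCoeff (σ := σ) (R := D)).mapMatrix (m := Fin N)))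
  exact ⟨r, hr, (h1.mapMatrix_stdIdempotent MvPolynomial.C).trans h.symm⟩

/-- Suppose that over `D[x₁, …, xₙ]` idempotent matrices are conjugate to constant ones, where `D`
is the localization of `A₀[X]` at the monic polynomials, for `A₀` a local principal ideal domain.
Then at each maximal ideal of `A₀[x₁, …, xₙ]` idempotent matrices over `A₀[x₁, …, xₙ][X]` become
conjugate to standard ones. -/
lemma exists_isConj_stdIdempotent_localization {n : ℕ} {K : Type u} [CommRing K]
    (hK : IsLocallyPIDDomain K)
    (ih : ∀ (D : Type u) [CommRing D], IsLocallyPIDDomain D → ∀ (N : ℕ)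
      (E : Matrix (Fin N) (Fin N) (MvPolynomial (Fin n) D)), IsIdempotentElem E →
        IsConj E ((MvPolynomial.C.comp MvPolynomial.constantCoeff).mapMatrix E))
    {N : ℕ} {E : Matrix (Fin N) (Fin N) (MvPolynomial (Fin n) K)[X]} (hE : IsIdempotentElem E)
    (M : Ideal (MvPolynomial (Fin n) K)) [M.IsMaximal] :
    ∃ r, IsConj (stdIdempotent (Localization.AtPrime M)[X] N r)
      ((mapRingHom (algebraMap _ (Localization.AtPrime M))).mapMatrix E) := by
  have := hK.isDomain
  let A := Localization.AtPrime M
  let Λ := Localization (monicSubmonoid A)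
  have hp : (M.comap (MvPolynomial.C : K →+* MvPolynomial (Fin n) K)).IsPrime := inferInstance
  -- M ∩ K is prime but need not be maximal. Elements outside any larger m still avoid M, so K_m
  -- maps to the localization at M.
  obtain ⟨m, hm, hMm⟩ := Ideal.exists_le_maximal _ hp.ne_top
  let A₀ := Localization.AtPrime m
  have : IsPrincipalIdealRing A₀ := hK.isPrincipalIdealRing_localization m
  have : IsDomain A₀ := IsLocalization.isDomain_localization m.primeCompl_le_nonZeroDivisors
  let D := Localization (monicSubmonoid A₀)
  have : IsDomain D := IsLocalization.isDomain_localization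
    (M := monicSubmonoid A₀) fun p hp => Monic.mem_nonZeroDivisors hp
  have : IsPrincipalIdealRing D := isPrincipalIdealRing_localization_monic (A := A₀) D
  let β : A₀ →+* A := IsLocalization.lift (M := m.primeCompl)
    (g := (algebraMap _ A).comp (MvPolynomial.C : K →+* MvPolynomial (Fin n) K)) fun y =>
      IsLocalization.map_units A (⟨MvPolynomial.C (y : K), fun h => y.2 (hMm h)⟩ : M.primeCompl)
  have hβ : ∀ k, β (algebraMap K A₀ k) = algebraMap (MvPolynomial (Fin n) K) A (MvPolynomial.C k) :=
    fun k => IsLocalization.lift_eq _ k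
  let γ : D →+* Λ := IsLocalization.lift (M := monicSubmonoid A₀)
    (g := (algebraMap A[X] Λ).comp (mapRingHom β)) fun y =>
      isUnit_algebraMap_of_monic (Monic.map β y.2)
  have hγ : ∀ p, γ (algebraMap A₀[X] D p) = algebraMap A[X] Λ (mapRingHom β p) :=
    fun p => IsLocalization.lift_eq _ p
  -- φ moves X into the coefficient ring D and keeps the xᵢ as variables; ψ sends them back to their
  -- images in Λ.
  let φ : (MvPolynomial (Fin n) K)[X] →+* MvPolynomial (Fin n) D :=
    eval₂RingHom (MvPolynomial.map ((algebraMap A₀[X] D).comp (C.comp (algebraMap K A₀))))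
      (MvPolynomial.C (algebraMap A₀[X] D X))
  let ψ : MvPolynomial (Fin n) D →+* Λ := MvPolynomial.eval₂Hom γ
    fun i => algebraMap A[X] Λ (C (algebraMap (MvPolynomial (Fin n) K) A (MvPolynomial.X i)))
  have hψφ : ψ.comp φ = (algebraMap A[X] Λ).comp (mapRingHom (algebraMap (MvPolynomial (Fin n) K) A)) := by
    apply Polynomial.ringHom_ext
    · intro a
      change (ψ.comp (φ.comp C)) a = (((algebraMap A[X] Λ).comp (mapRingHom (algebraMap (MvPolynomial (Fin n) K) A))).comp C) a
      refine RingHom.congr_fun ?_ a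
      apply MvPolynomial.ringHom_ext
      · intro k
        simp [φ, ψ, hγ, hβ]
      · intro i
        simp [φ, ψ]
    · simp [φ, ψ, hγ]
  have hEφ := hE.map (φ.mapMatrix (m := Fin N))
  obtain ⟨r, hr, h1⟩ := exists_isConj_stdIdempotent_of_isConj_constant hEφ
    (ih D (isLocallyPIDDomain_of_isPrincipalIdealRing D) N (φ.mapMatrix E) hEφ)
  have h4 : IsConj (stdIdempotent Λ N r) ((ψ.comp φ).mapMatrix E) := h1.mapMatrix_stdIdempotent ψ
  rw [hψφ] at h4
  exact ⟨r, isConj_stdIdempotent_of_localization_monic Λ (hE.map (RingHom.mapMatrix _)) hr h4⟩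

/-- Idempotent matrices over `K[x₁, …, xₙ]` are conjugate to their constant terms. -/
theorem isConj_constant_of_isLocallyPIDDomain (n : ℕ) : ∀ (K : Type u) [CommRing K],
    IsLocallyPIDDomain K → ∀ (N : ℕ) (E : Matrix (Fin N) (Fin N) (MvPolynomial (Fin n) K)),
      IsIdempotentElem E →
        IsConj E ((MvPolynomial.C.comp MvPolynomial.constantCoeff).mapMatrix E) := by
  induction n with
  | zero =>
    intro K _ _ N E _
    have : (MvPolynomial.C.comp MvPolynomial.constantCoeff :
        MvPolynomial (Fin 0) K →+* MvPolynomial (Fin 0) K) = RingHom.id _ := by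
      apply MvPolynomial.ringHom_ext
      · intro k
        simp
      · exact fun i => i.elim0
    rw [this]
    have e : (RingHom.id (MvPolynomial (Fin 0) K)).mapMatrix E = E := by
      ext1 i j
      rfl
    rw [e]
  | succ n ih =>
    intro K _ hK N E hE
    let Φ := (MvPolynomial.finSuccEquiv K n).toRingEquiv
    let E' := Φ.toRingHom.mapMatrix E
    have hE' : IsIdempotentElem E' := hE.map (Φ.toRingHom.mapMatrix (m := Fin N))
    have h1 : IsConj E' ((C.comp constantCoeff).mapMatrix E') :=
      isConj_constant_of_forall_isMaximal E' fun M _ => by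
        obtain ⟨r, hr⟩ := exists_isConj_stdIdempotent_localization hK ih hE' M
        exact isConj_constant_of_isConj_stdIdempotent hr
    -- Patching removed only X; the induction hypothesis over K itself removes the other variables.
    have h2 := (C.mapMatrix (m := Fin N)).toMonoidHom.map_isConj
      (ih K hK N (constantCoeff.mapMatrix E') (hE'.map (constantCoeff.mapMatrix (m := Fin N))))
    have h3 := (Φ.symm.toRingHom.mapMatrix (m := Fin N)).toMonoidHom.map_isConj (h1.trans h2)
    have e1 : Φ.symm.toRingHom.comp Φ.toRingHom = RingHom.id _ :=
      RingHom.ext fun x => Φ.symm_apply_apply x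
    have e2 : Φ.symm.toRingHom.comp (C.comp ((MvPolynomial.C.comp MvPolynomial.constantCoeff).comp
        (constantCoeff.comp Φ.toRingHom))) = MvPolynomial.C.comp MvPolynomial.constantCoeff := by
      refine RingHom.ext fun x => ?_
      apply Φ.injective
      change Φ (Φ.symm _) = _
      rw [Φ.apply_symm_apply]
      refine RingHom.congr_fun (f := (C.comp ((MvPolynomial.C.comp
        MvPolynomial.constantCoeff).comp (constantCoeff.comp Φ.toRingHom))))
        (g := Φ.toRingHom.comp (MvPolynomial.C.comp MvPolynomial.constantCoeff)) ?_ x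
      apply MvPolynomial.ringHom_ext
      · intro k
        simp [Φ, MvPolynomial.finSuccEquiv_apply]
      · intro i
        refine Fin.cases ?_ (fun i => ?_) i <;> simp [Φ, MvPolynomial.finSuccEquiv_apply]
    change IsConj ((Φ.symm.toRingHom.comp Φ.toRingHom).mapMatrix E)
      ((Φ.symm.toRingHom.comp (C.comp ((MvPolynomial.C.comp MvPolynomial.constantCoeff).comp
        (constantCoeff.comp Φ.toRingHom)))).mapMatrix E) at h3
    rw [e1, e2] at h3
    exact h3

end Induction

/-! ### From idempotent matrices back to modules -/

section Retract

variable {R P P' V : Type*} [CommRing R] [AddCommGroup P] [AddCommGroup P'] [AddCommGroup V]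
  [Module R P] [Module R P'] [Module R V]

/-- Retracts of a module belonging to conjugate idempotents are isomorphic. -/
lemma nonempty_linearEquiv_of_retract {i : P →ₗ[R] V} {p : V →ₗ[R] P} {i' : P' →ₗ[R] V}
    {p' : V →ₗ[R] P'} (hp : p ∘ₗ i = LinearMap.id) (hp' : p' ∘ₗ i' = LinearMap.id)
    (u : V ≃ₗ[R] V) (hu : ∀ x, u (i (p x)) = i' (p' (u x))) : Nonempty (P ≃ₗ[R] P') := by
  have hp : ∀ x, p (i x) = x := LinearMap.congr_fun hp
  have hp' : ∀ x, p' (i' x) = x := LinearMap.congr_fun hp'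
  refine ⟨LinearEquiv.ofLinearMap (p' ∘ₗ u.toLinearMap ∘ₗ i) (p ∘ₗ u.symm.toLinearMap ∘ₗ i') ?_ ?_⟩
  · ext x
    have h1 := hu (u.symm (i' x))
    rw [LinearEquiv.apply_symm_apply, hp'] at h1
    change p' (u (i (p (u.symm (i' x))))) = x
    rw [h1, hp']
  · ext x
    have h1 := hu (i x)
    rw [hp] at h1
    change p (u.symm (i' (p' (u (i x))))) = x
    rw [← h1, LinearEquiv.symm_apply_apply, hp]

end Retract

section Extended

variable {K : Type u} [CommRing K] {R : Type*} [CommRing R] [Algebra K R] {N : ℕ}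

lemma piScalarRight_one_tmul (x : Fin N → K) :
    TensorProduct.piScalarRight K R R (Fin N) (1 ⊗ₜ[K] x) = fun i => algebraMap K R (x i) := by
  funext i
  simp [Algebra.smul_def]

lemma piScalarRight_baseChange_toLin' (e : Matrix (Fin N) (Fin N) K)
    (x : R ⊗[K] (Fin N → K)) :
    TensorProduct.piScalarRight K R R (Fin N) ((Matrix.toLin' e).baseChange R x) =
      Matrix.toLin' ((algebraMap K R).mapMatrix e)
        (TensorProduct.piScalarRight K R R (Fin N) x) := by
  induction x using TensorProduct.induction_on with
  | zero => simp
  | add x y hx hy => simp only [map_add, hx, hy]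
  | tmul r x =>
    have : r ⊗ₜ[K] x = r • (1 ⊗ₜ[K] x : R ⊗[K] (Fin N → K)) := by
      rw [TensorProduct.smul_tmul', smul_eq_mul, mul_one]
    rw [this, map_smul, map_smul, map_smul, map_smul, LinearMap.baseChange_tmul,
      piScalarRight_one_tmul, piScalarRight_one_tmul]
    congr 1
    funext i
    simp [Matrix.mulVec, dotProduct]

/-- A finite projective `R`-module, for `R` a `K`-algebra over which idempotent matrices are
conjugate to matrices over `K`, is extended from a finite projective `K`-module. -/
lemma exists_projective_extended (hinj : Function.Injective (algebraMap K R))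
    (h : ∀ (N : ℕ) (E : Matrix (Fin N) (Fin N) R), IsIdempotentElem E →
      ∃ e : Matrix (Fin N) (Fin N) K, IsIdempotentElem e ∧
        IsConj E ((algebraMap K R).mapMatrix e))
    (P : Type v) [AddCommGroup P] [Module R P] [Module.Finite R P] [Module.Projective R P] :
    ∃ (P₀ : Type v) (_ : AddCommGroup P₀) (_ : Module K P₀),
      Module.Finite K P₀ ∧ Module.Projective K P₀ ∧ Nonempty (P ≃ₗ[R] (R ⊗[K] P₀)) := by
  obtain ⟨N, p, hp⟩ := Module.Finite.exists_fin' R P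
  obtain ⟨i, hi⟩ := Module.projective_lifting_property p LinearMap.id hp
  let E := LinearMap.toMatrix' (i ∘ₗ p)
  have hE : IsIdempotentElem E := by
    rw [IsIdempotentElem, ← LinearMap.toMatrix'_comp]
    congr 1
    rw [LinearMap.comp_assoc, ← LinearMap.comp_assoc p, hi, LinearMap.id_comp]
  obtain ⟨e, he, U, hU⟩ := h N E hE
  let f := Matrix.toLin' e
  have hf : IsIdempotentElem f := by
    rw [IsIdempotentElem, Module.End.mul_eq_comp, ← Matrix.toLin'_mul, he.eq]
  let i₀ := (LinearMap.range f).subtype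
  let p₀ := f.rangeRestrict
  have hp₀ : p₀ ∘ₗ i₀ = LinearMap.id := by
    refine LinearMap.ext fun x => Subtype.ext ?_
    exact (LinearMap.IsIdempotentElem.mem_range_iff hf).1 x.2
  have hif : i₀ ∘ₗ p₀ = f := LinearMap.ext fun x => rfl
  let s := TensorProduct.piScalarRight K R R (Fin N)
  let i₁ := s.toLinearMap ∘ₗ i₀.baseChange R
  let p₁ := p₀.baseChange R ∘ₗ s.symm.toLinearMap
  have hp₁ : p₁ ∘ₗ i₁ = LinearMap.id := by
    refine LinearMap.ext fun x => ?_
    change p₀.baseChange R (s.symm (s (i₀.baseChange R x))) = x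
    rw [LinearEquiv.symm_apply_apply, ← LinearMap.comp_apply, ← LinearMap.baseChange_comp, hp₀,
      LinearMap.baseChange_id]
    rfl
  have hip₁ : ∀ x, i₁ (p₁ x) = Matrix.toLin' ((algebraMap K R).mapMatrix e) x := by
    intro x
    change s (i₀.baseChange R (p₀.baseChange R (s.symm x))) = _
    rw [← LinearMap.comp_apply, ← LinearMap.baseChange_comp, hif,
      piScalarRight_baseChange_toLin', LinearEquiv.apply_symm_apply]
  let u : (Fin N → R) ≃ₗ[R] (Fin N → R) := Matrix.toLin'OfInv U.inv_mul U.mul_inv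
  obtain ⟨Θ⟩ := nonempty_linearEquiv_of_retract hi hp₁ u fun x => by
    have h1 : i (p x) = E.mulVec x := by
      rw [← Matrix.toLin'_apply, Matrix.toLin'_toMatrix']
      rfl
    rw [hip₁, h1]
    change (U : Matrix (Fin N) (Fin N) R).mulVec (E.mulVec x) =
      ((algebraMap K R).mapMatrix e).mulVec ((U : Matrix (Fin N) (Fin N) R).mulVec x)
    rw [Matrix.mulVec_mulVec, Matrix.mulVec_mulVec, hU.eq]
  -- The image of f lives in the universe of K, while P₀ is wanted in that of P. Injectivity of K →
  -- R embeds it in P by x ↦ Θ⁻¹(1 ⊗ x).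
  have hsmall : Small.{v} (LinearMap.range f) := by
    refine small_of_injective (β := P) (f := fun x => Θ.symm (1 ⊗ₜ x)) fun x y hxy => ?_
    have h1 : s (i₀.baseChange R (1 ⊗ₜ x)) = s (i₀.baseChange R (1 ⊗ₜ y)) :=
      congrArg i₁ (Θ.symm.injective hxy)
    rw [LinearMap.baseChange_tmul, LinearMap.baseChange_tmul, piScalarRight_one_tmul,
      piScalarRight_one_tmul] at h1
    exact Subtype.ext (funext fun j => hinj (congrFun h1 j))
  have hproj : Module.Projective K (LinearMap.range f) := Module.Projective.of_split i₀ p₀ hp₀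
  let σ : Shrink.{v} (LinearMap.range f) ≃ₗ[K] LinearMap.range f := Shrink.linearEquiv K _
  exact ⟨Shrink.{v} (LinearMap.range f), inferInstance, inferInstance, Module.Finite.equiv σ.symm,
    Module.Projective.of_equiv σ.symm, ⟨Θ.trans (LinearEquiv.baseChange K R _ _ σ.symm)⟩⟩

end Extended

theorem mainTheorem1 (n : ℕ) (K : Type u) [CommRing K] (hK : IsLocallyPIDDomain K)
    (P : Type v) [AddCommGroup P] [Module (MvPolynomial (Fin n) K) P]
    [Module.Finite (MvPolynomial (Fin n) K) P] [Module.Projective (MvPolynomial (Fin n) K) P] :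
    (∃ (P₀ : Type v) (_ : AddCommGroup P₀) (_ : Module K P₀),
      Module.Finite K P₀ ∧ Module.Projective K P₀ ∧
      Nonempty (P ≃ₗ[MvPolynomial (Fin n) K] (MvPolynomial (Fin n) K ⊗[K] P₀))) ∧
    (IsPrincipalIdealRing K →
      (∀ (P₀ : Type v) [AddCommGroup P₀] [Module K P₀] [Module.Finite K P₀]
        [Module.Projective K P₀],
        Nonempty (P ≃ₗ[MvPolynomial (Fin n) K] (MvPolynomial (Fin n) K ⊗[K] P₀)) →
        Module.Free K P₀) ∧
      Module.Free (MvPolynomial (Fin n) K) P) ∧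
    (IsField K → Module.Free (MvPolynomial (Fin n) K) P) := by
  have := hK.isDomain
  have hext := exists_projective_extended (K := K) (R := MvPolynomial (Fin n) K)
    (MvPolynomial.C_injective _ _) (fun N E hE =>
      ⟨MvPolynomial.constantCoeff.mapMatrix E,
        hE.map (MvPolynomial.constantCoeff.mapMatrix (m := Fin N)),
        isConj_constant_of_isLocallyPIDDomain n K hK N E hE⟩) P
  have hfree : IsPrincipalIdealRing K → Module.Free (MvPolynomial (Fin n) K) P := by
    intro _
    obtain ⟨P₀, _, _, _, _, ⟨θ⟩⟩ := hext
    -- Finitely generated projectives over a PID are free, and base change preserves freeness.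
    have : Module.Free K P₀ := inferInstance
    exact Module.Free.of_equiv θ.symm
  refine ⟨hext, fun hPID => ⟨fun P₀ _ _ _ _ _ => inferInstance, hfree hPID⟩, fun hF => hfree ?_⟩
  let := hF.toField
  exact inferInstanceAs (IsPrincipalIdealRing K)
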